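/- Let $\gamma:\mathbb C^n\to\mathbb C^n$ be an invertible holomorphic contraction centred at $0$, that is, a biholomorphism of $\mathbb C^n$ with $\gamma(0)=0$ such that for every compact $K\subset\mathbb C^n$ and every open $U\ni 0$ one has $\gamma^m(K)\subset U$ for all sufficiently large $m$. Let $A=D_0\gamma$ be its differential at $0$. A complex $n\times n$ matrix with eigenvalues $\alpha_1,\dots,\alpha_n$ (with multiplicity) is called *resonant* if $\alpha_j=\prod_{i=1}^n\alpha_i^{k_i}$ for some $j$ and some integers $k_i\ge 0$ with $\sum_i k_i\ge 2$. A $\gamma$-equivariant structure on a holomorphic vector bundle $B$ over $\mathbb C^n$ is a family of linear isomorphisms $\varphi_x:B_x\to B_{\gamma(x)}$, $x\in\mathbb C^n$, that depends holomorphically on $x$. The equivariant bundle $B$ is called *resonant* if there are eigenvalues $\beta,\beta'$ (possibly equal) of $\varphi_0$ on the fibre $B_0$, an integer $k\ge 1$, and eigenvalues $a_1,\dots,a_k$ of $A$ (repetitions allowed) with $\beta=\beta'\prod_{l=1}^k a_l$. A holomorphic section $R$ of $\Omega^1(\mathbb C^n)\otimes\operatorname{End}(B)$ is *$\gamma^*$-invariant*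 if $\varphi_x^{-1}\circ R_{\gamma(x)}(D_x\gamma\, v)\circ\varphi_x=R_x(v)$ for all $x\in\mathbb C^n$ and $v\in T_x\mathbb C^n$. The natural equivariant structure on $T\mathbb C^n$ is $\varphi_x=D_x\gamma$. Then the following are equivalent: (i) the matrix $A$ is resonant; (ii) there exists a nonzero $\gamma^*$-invariant global holomorphic section of $\Omega^1(\mathbb C^n)\otimes\operatorname{End}(T\mathbb C^n)$; (iii) the bundle $T\mathbb C^n$ with its natural $\gamma$-equivariant structure is resonant. -/

import Mathlib

open scoped Manifold ContDiff Bundle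

noncomputable section

/-- A continuous self-map `f` fixing `x` is a contraction centred at `x` if every compact set is
taken into every given open neighbourhood of `x` by all sufficiently high powers of `f`. -/
structure IsContractionAt {M : Type*} [TopologicalSpace M] (f : M → M) (x : M) : Prop where
  continuous : Continuous f
  map_center : f x = x
  eventually_mapsTo : ∀ K U : Set M, IsCompact K → IsOpen U → x ∈ U →
    ∀ᶠ m : ℕ in Filter.atTop, Set.MapsTo (f^[m]) K U

/-- A square complex matrix with eigenvalues `α₁, …, αₙ` (listed with algebraic multiplicity) is
resonant if one of the eigenvalues equals `∏ αᵢ ^ kᵢ` for some natural numbers `kᵢ` with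
`∑ kᵢ ≥ 2`. -/
def Matrix.IsResonant {n : ℕ} (A : Matrix (Fin n) (Fin n) ℂ) : Prop :=
  ∃ α : Fin n → ℂ, A.charpoly.roots = Finset.univ.val.map α ∧
    ∃ (j : Fin n) (k : Fin n → ℕ), 2 ≤ ∑ i, k i ∧ α j = ∏ i, α i ^ k i

/-- Complex `n`-space. -/
abbrev CSpace (n : ℕ) : Type := EuclideanSpace ℂ (Fin n)

/-- The biholomorphisms of `ℂⁿ` onto itself. Over `ℂ`, the smoothness exponent `ω` (analytic)
means holomorphic. -/
abbrev CSpace.Biholomorphism (n : ℕ) : Type :=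
  CSpace n ≃ₘ^ω⟮𝓘(ℂ, CSpace n), 𝓘(ℂ, CSpace n)⟯ CSpace n

/-- The matrix, in the standard basis of `ℂⁿ`, of the differential of `f` at `x`. -/
def CSpace.jacobian {n : ℕ} (f : CSpace n → CSpace n) (x : CSpace n) :
    Matrix (Fin n) (Fin n) ℂ :=
  LinearMap.toMatrix (EuclideanSpace.basisFun (Fin n) ℂ).toBasis
    (EuclideanSpace.basisFun (Fin n) ℂ).toBasis (fderiv ℂ f x : CSpace n →ₗ[ℂ] CSpace n)

/-- A `γ`-equivariant structure on a holomorphic vector bundle `B` over `ℂⁿ` (of finite rank, with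
model fibre `F`): linear isomorphisms `B_x ≃ B_{γ x}` which together form a holomorphic self-map of
the total space covering `γ`. -/
structure EquivariantStructure {n : ℕ} (γ : CSpace.Biholomorphism n)
    (F : Type*) [NormedAddCommGroup F] [NormedSpace ℂ F] [FiniteDimensional ℂ F]
    (B : CSpace n → Type*) [TopologicalSpace (Bundle.TotalSpace F B)]
    [∀ x, TopologicalSpace (B x)] [∀ x, AddCommGroup (B x)] [∀ x, Module ℂ (B x)]
    [FiberBundle F B] [VectorBundle ℂ F B] [ContMDiffVectorBundle ω F B 𝓘(ℂ, CSpace n)] where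
  lift : ∀ x : CSpace n, B x ≃L[ℂ] B (γ x)
  contMDiff_lift :
    ContMDiff (𝓘(ℂ, CSpace n).prod 𝓘(ℂ, F)) (𝓘(ℂ, CSpace n).prod 𝓘(ℂ, F)) ω
      (fun p : Bundle.TotalSpace F B => (⟨γ p.proj, lift p.proj p.2⟩ : Bundle.TotalSpace F B))

namespace EquivariantStructure

section

variable {n : ℕ} {γ : CSpace.Biholomorphism n}
  {F : Type*} [NormedAddCommGroup F] [NormedSpace ℂ F] [FiniteDimensional ℂ F]
  {B : CSpace n → Type*} [TopologicalSpace (Bundle.TotalSpace F B)]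
  [∀ x, TopologicalSpace (B x)] [∀ x, AddCommGroup (B x)] [∀ x, Module ℂ (B x)]
  [FiberBundle F B] [VectorBundle ℂ F B] [ContMDiffVectorBundle ω F B 𝓘(ℂ, CSpace n)]

/-- The linear operator by which `γ` acts on the fibre over a fixed point `x`: the lift
`B_x → B_{γ x}`, where `B_{γ x}` is `B_x` because `γ x = x`. -/
def fiberEnd (S : EquivariantStructure γ F B) (x : CSpace n) (hx : γ x = x) :
    Module.End ℂ (B x) :=
  (LinearEquiv.cast (R := ℂ) (M := B) hx).toLinearMap ∘ₗ (S.lift x).toLinearEquiv.toLinearMap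

/-- A `γ`-equivariant bundle, where `γ` fixes `0`, is resonant if `βᵢ = βⱼ · ∏ₗ α_{iₗ}` for two
eigenvalues `βᵢ`, `βⱼ` (possibly equal) of `γ` on the fibre over `0` and a nonempty collection
(with repetitions allowed) of eigenvalues `α_{iₗ}` of the differential of `γ` at `0`. -/
def IsResonant (S : EquivariantStructure γ F B) (h0 : γ 0 = 0) : Prop :=
  ∃ β β' : ℂ, (S.fiberEnd 0 h0).HasEigenvalue β ∧ (S.fiberEnd 0 h0).HasEigenvalue β' ∧
    ∃ s : Multiset ℂ, 1 ≤ s.card ∧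
      (∀ a ∈ s, Module.End.HasEigenvalue (fderiv ℂ γ 0 : Module.End ℂ (CSpace n)) a) ∧
      β = β' * s.prod

end

section

variable {n : ℕ} {γ : CSpace.Biholomorphism n}
  {F : Type*} [NormedAddCommGroup F] [NormedSpace ℂ F] [FiniteDimensional ℂ F]
  {B : CSpace n → Type*} [TopologicalSpace (Bundle.TotalSpace F B)]
  [∀ x, TopologicalSpace (B x)] [∀ x, AddCommGroup (B x)] [∀ x, Module ℂ (B x)]
  [∀ x, IsTopologicalAddGroup (B x)] [∀ x, ContinuousSMul ℂ (B x)]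
  [FiberBundle F B] [VectorBundle ℂ F B] [ContMDiffVectorBundle ω F B 𝓘(ℂ, CSpace n)]

/-- The space of global holomorphic sections of `Ω¹(ℂⁿ) ⊗ End(B)`, that is, of the holomorphic
vector bundle `Hom(Tℂⁿ, End(B))`. -/
abbrev EndForm (n : ℕ) (F : Type*) [NormedAddCommGroup F] [NormedSpace ℂ F]
    (B : CSpace n → Type*) [TopologicalSpace (Bundle.TotalSpace F B)]
    [∀ x, TopologicalSpace (B x)] [∀ x, AddCommGroup (B x)] [∀ x, Module ℂ (B x)]
    [∀ x, IsTopologicalAddGroup (B x)] [∀ x, ContinuousSMul ℂ (B x)]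
    [FiberBundle F B] [VectorBundle ℂ F B] : Type _ :=
  ContMDiffSection 𝓘(ℂ, CSpace n) (CSpace n →L[ℂ] F →L[ℂ] F) ω
    (fun x : CSpace n => TangentSpace 𝓘(ℂ, CSpace n) x →L[ℂ] B x →L[ℂ] B x)

/-- The value at `(x, v)` of the pullback `γ^*R` of an `End(B)`-valued 1-form `R`: the endomorphism
`R_{γ x}(D_xγ v)` of `B_{γ x}`, transported to `B_x` by the equivariant structure. -/
def pullback (S : EquivariantStructure γ F B) (R : EndForm n F B) (x : CSpace n)
    (v : TangentSpace 𝓘(ℂ, CSpace n) x) : B x →L[ℂ] B x :=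
  ((S.lift x).symm : B (γ x) →L[ℂ] B x) ∘L
    R (γ x) (mfderiv 𝓘(ℂ, CSpace n) 𝓘(ℂ, CSpace n) γ x v) ∘L (S.lift x : B x →L[ℂ] B (γ x))

/-- `R` is `γ^*`-invariant: `γ^*R = R`. -/
def IsInvariant (S : EquivariantStructure γ F B) (R : EndForm n F B) : Prop :=
  ∀ (x : CSpace n) (v : TangentSpace 𝓘(ℂ, CSpace n) x), S.pullback R x v = R x v

end

/-- The natural equivariant structure on the tangent bundle of `ℂⁿ`: `γ` acts by its differentials
`D_xγ : T_xℂⁿ → T_{γ x}ℂⁿ`. -/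
def tangent {n : ℕ} (γ : CSpace.Biholomorphism n) :
    EquivariantStructure γ (CSpace n) (TangentSpace 𝓘(ℂ, CSpace n) : CSpace n → Type) where
  lift x := γ.mfderivToContinuousLinearEquiv (by simp) x
  contMDiff_lift := by
    have h := γ.contMDiff.contMDiff_tangentMap (m := ω) (by simp)
    exact h

end EquivariantStructure

end

/-! Write `A` for the differential of `γ` at `0`. Invariant sections are the fixed points of the
operator `T f x = M x (f (γ x))`, where `M x` conjugates a bilinear map by the differential of `γ`
at `x`. Conditions (i) and (iii) both say that a product of at least two eigenvalues of `A` is again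
an eigenvalue; in (iii) the factor `β'` is one of them.

(ii) ⇒ (iii): the lowest nonvanishing Taylor coefficient at `0` of a fixed point, of order `k` say,
is an `A`-equivariant multilinear map with `k + 2` arguments (`iteratedFDeriv_weightedComp`). Such a
map forces a product of `k + 2` eigenvalues of `A` to be an eigenvalue
(`MultilinearMap.exists_hasEigenvalue_prod`).

(iii) ⇒ (ii): let `β` be an eigenvalue that is a product of `k + 2` eigenvalues. Evaluating
order-`k` coefficients at eigenvectors for the factors and pairing with an eigencovector for `β`
gives a functional preserved by `T`. So `T - 1` is not surjective on the finite-dimensional space of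
`N`-jets, hence not injective (`exists_sub_mem_ker_of_dual_fixed`): some nonzero jet is fixed. Some
iterate of `γ` halves norms on the unit ball, so for large `N` the corresponding power `T ^ p`
contracts functions vanishing to order `N + 1`. A geometric series then corrects the jet to an
entire fixed point of `T ^ p` (`exists_analytic_eq_add_weightedComp`), and uniqueness makes it fixed
by `T` (`eq_zero_of_weightedComp_eq`). -/

/-! ### Cauchy estimates, Taylor series and uniform limits of analytic maps -/

open Metric Filter Topology in
/-- Iterated Cauchy estimate. -/
theorem norm_iteratedFDeriv_le_of_forall_mem_ball {E F : Type*} [NormedAddCommGroup E]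
    [NormedSpace ℂ E] [NormedAddCommGroup F] [NormedSpace ℂ F] [CompleteSpace F] {f : E → F}
    {M δ : ℝ} (hδ : 0 < δ) (k : ℕ) (x : E)
    (hf : AnalyticOnNhd ℂ f (ball x ((k + 1) * δ)))
    (hM : ∀ y ∈ ball x ((k + 1) * δ), ‖f y‖ ≤ M) :
    ‖iteratedFDeriv ℂ k f x‖ ≤ M * (2 / δ) ^ k := by
  induction k generalizing x with
  | zero => simpa using hM x (by simpa using hδ)
  | succ k ih =>
    have hsub : ∀ y ∈ ball x δ, ball y ((k + 1) * δ) ⊆ ball x (((k + 1 : ℕ) + 1) * δ) := by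
      intro y hy
      refine ball_subset_ball' ?_
      have := mem_ball.1 hy
      push_cast
      linarith
    have hb : ∀ y ∈ ball x δ, ‖iteratedFDeriv ℂ k f y‖ ≤ M * (2 / δ) ^ k := fun y hy =>
      ih y (hf.mono (hsub y hy)) fun z hz => hM z (hsub y hy hz)
    have hxx : x ∈ ball x δ := mem_ball_self hδ
    have hd : DifferentiableOn ℂ (iteratedFDeriv ℂ k f) (ball x δ) := fun y hy =>
      (hf.iteratedFDeriv k y
        (hsub y hy (mem_ball_self (by positivity)))).differentiableAt.differentiableWithinAt
    rw [← norm_fderiv_iteratedFDeriv]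
    -- The values stay within twice the inductive bound of the central one, whence the factor `2`;
    -- each derivative uses up `δ` of the radius.
    have := Complex.norm_fderiv_le_div_of_mapsTo_ball (R₂ := 2 * (M * (2 / δ) ^ k)) hd (fun y hy => by
      rw [mem_closedBall_iff_norm]
      have h1 := norm_sub_le (iteratedFDeriv ℂ k f y) (iteratedFDeriv ℂ k f x)
      linarith [hb y hy, hb x hxx]) hδ
    refine this.trans (le_of_eq ?_)
    rw [pow_succ]
    ring

-- Splitting the radius into `k + 1` equal steps gives `(k + 1) ^ k / k!`, which is at most `exp (k
-- + 1)`; the growth in `k` is therefore only geometric.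
open Metric Filter Topology in
theorem norm_iteratedFDeriv_div_factorial_le {E F : Type*} [NormedAddCommGroup E]
    [NormedSpace ℂ E] [NormedAddCommGroup F] [NormedSpace ℂ F] [CompleteSpace F] {f : E → F}
    {M r : ℝ} (hr : 0 < r) (k : ℕ) (x : E)
    (hf : AnalyticOnNhd ℂ f (ball x r)) (hM : ∀ y ∈ ball x r, ‖f y‖ ≤ M) :
    ‖((k.factorial : ℂ)⁻¹ • iteratedFDeriv ℂ k f x : E [×k]→L[ℂ] F)‖ ≤
      M * Real.exp 1 * (2 * Real.exp 1 / r) ^ k := by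
  have hk : (0 : ℝ) < (k : ℝ) + 1 := by positivity
  have hδ : ((k : ℝ) + 1) * (r / (k + 1)) = r := by field_simp
  have h := norm_iteratedFDeriv_le_of_forall_mem_ball (M := M) (δ := r / (k + 1)) (f := f)
    (by positivity) k x (by rwa [hδ]) (by rwa [hδ])
  have hM0 : 0 ≤ M := (norm_nonneg _).trans (hM x (mem_ball_self hr))
  have hfac : (0 : ℝ) < k.factorial := by positivity
  have he := Real.pow_div_factorial_le_exp ((k : ℝ) + 1) hk.le k
  rw [norm_smul, norm_inv, Complex.norm_natCast]
  calc (k.factorial : ℝ)⁻¹ * ‖iteratedFDeriv ℂ k f x‖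
      ≤ (k.factorial : ℝ)⁻¹ * (M * (2 / (r / (k + 1))) ^ k) := by gcongr
    _ = M * (2 / r) ^ k * (((k : ℝ) + 1) ^ k / k.factorial) := by
        rw [← div_mul, mul_pow]; field_simp
    _ ≤ M * (2 / r) ^ k * Real.exp ((k : ℝ) + 1) := by gcongr
    _ = M * Real.exp 1 * (2 * Real.exp 1 / r) ^ k := by
        rw [Real.exp_add, ← Real.exp_one_pow, mul_div_right_comm, mul_pow]; ring

open Metric Filter Topology in
theorem HasFPowerSeriesOnBall.iteratedFDeriv_apply_diag {E F : Type*} [NormedAddCommGroup E]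
    [NormedSpace ℂ E] [NormedAddCommGroup F] [NormedSpace ℂ F] [CompleteSpace F] {f : E → F}
    {p : FormalMultilinearSeries ℂ E F} {x : E} {r : ENNReal} (h : HasFPowerSeriesOnBall f p x r)
    (k : ℕ) (y : E) :
    ((k.factorial : ℂ)⁻¹ • iteratedFDeriv ℂ k f x : E [×k]→L[ℂ] F) (fun _ => y) =
      p k fun _ => y := by
  have hk : (k.factorial : ℂ) ≠ 0 := by exact_mod_cast k.factorial_ne_zero
  rw [smul_apply, h.iteratedFDeriv_eq_sum_of_completeSpace]
  simp [Fintype.card_perm, ← Nat.cast_smul_eq_nsmul ℂ, inv_smul_smul₀ hk]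

open Metric Filter Topology in
/-- The Taylor series at `x` of a bounded analytic function on a ball centred at `x` converges to
it on a smaller concentric ball. -/
theorem AnalyticOnNhd.hasSum_taylor_of_norm_le {E F : Type*} [NormedAddCommGroup E]
    [NormedSpace ℂ E] [NormedAddCommGroup F] [NormedSpace ℂ F] [CompleteSpace F] {f : E → F}
    {M r : ℝ} (hr : 0 < r) {x : E}
    (hf : AnalyticOnNhd ℂ f (ball x r)) (hM : ∀ y ∈ ball x r, ‖f y‖ ≤ M)
    {y : E} (hy : ‖y‖ < r / (4 * Real.exp 1)) :
    HasSum (fun k : ℕ => ((k.factorial : ℂ)⁻¹ • iteratedFDeriv ℂ k f x : E [×k]→L[ℂ] F)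
      fun _ => y) (f (x + y)) := by
  set q : FormalMultilinearSeries ℂ E F := fun k => (k.factorial : ℂ)⁻¹ • iteratedFDeriv ℂ k f x
    with hq
  have hM0 : 0 ≤ M := (norm_nonneg _).trans (hM x (mem_ball_self hr))
  have he : 0 < Real.exp 1 := Real.exp_pos 1
  -- At this radius the geometric ratio `2e / r` of the coefficient bound becomes `1 / 2`.
  have hρ0 : 0 < r / (4 * Real.exp 1) := by positivity
  set ρ : NNReal := ⟨r / (4 * Real.exp 1), hρ0.le⟩ with hρ
  have hρr : (ρ : ℝ) = r / (4 * Real.exp 1) := rfl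
  have hrad : (ρ : ENNReal) ≤ q.radius := by
    refine q.le_radius_of_bound (M * Real.exp 1) fun k => ?_
    calc ‖q k‖ * (ρ : ℝ) ^ k ≤ M * Real.exp 1 * (2 * Real.exp 1 / r) ^ k * (ρ : ℝ) ^ k := by
          gcongr; exact norm_iteratedFDeriv_div_factorial_le hr k x hf hM
      _ = M * Real.exp 1 * (1 / 2) ^ k := by
          rw [mul_assoc, ← mul_pow, hρr]; congr 2; field_simp; norm_num
      _ ≤ M * Real.exp 1 * 1 := by
          gcongr; exact pow_le_one₀ (by norm_num) (by norm_num)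
      _ = _ := mul_one _
  have hρpos : (0 : ENNReal) < ρ := by exact_mod_cast hρ0
  have hqs : HasFPowerSeriesOnBall q.sum q 0 ρ :=
    (q.hasFPowerSeriesOnBall (hρpos.trans_le hrad)).mono hρpos hrad
  have hball : Metric.eball (0 : E) ρ = ball 0 (ρ : ℝ) := Metric.eball_coe
  have hsub : ∀ z ∈ ball (0 : E) ρ, x + z ∈ ball x r := fun z hz => by
    rw [mem_ball_zero_iff] at hz
    have : (ρ : ℝ) ≤ r := by
      rw [hρr]; apply div_le_self hr.le; linarith [Real.add_one_le_exp 1]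
    simpa using hz.trans_le this
  have hfx : AnalyticOnNhd ℂ (fun z => f (x + z)) (ball 0 (ρ : ℝ)) := fun z hz =>
    (hf _ (hsub z hz)).comp_of_eq (by fun_prop) rfl
  obtain ⟨p, s, hp⟩ := hf x (mem_ball_self hr)
  -- Near `0` the sum is `f (x + z)`, because any local power series has the same diagonal values;
  -- the identity theorem extends this to the ball of radius `ρ`.
  have hev : q.sum =ᶠ[𝓝 0] fun z => f (x + z) := by
    filter_upwards [hp.eventually_hasSum] with z hz
    have : (fun k => q k fun _ => z) = fun k => p k fun _ => z := by
      ext k; exact hp.iteratedFDeriv_apply_diag k z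
    rw [FormalMultilinearSeries.sum, this, hz.tsum_eq]
  have heq := AnalyticOnNhd.eqOn_of_preconnected_of_eventuallyEq (hball ▸ hqs.analyticOnNhd) hfx
    (convex_ball _ _).isPreconnected (mem_ball_self hρ0) hev
  have hy' : y ∈ ball (0 : E) ρ := mem_ball_zero_iff.2 hy
  have hs := hqs.hasSum (hball ▸ hy')
  rw [zero_add] at hs
  have h2 := heq hy'
  simp only at h2
  rwa [h2] at hs

open Metric Filter Topology in
/-- Weierstrass `M`-test for analytic maps between Banach spaces. -/
theorem analyticAt_tsum_of_summable_norm {E F : Type*} [NormedAddCommGroup E]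
    [NormedSpace ℂ E] [NormedAddCommGroup F] [NormedSpace ℂ F] [CompleteSpace F]
    {f : ℕ → E → F} {u : ℕ → ℝ} (hu : Summable u) {r : ℝ} (hr : 0 < r) {x : E}
    (hf : ∀ i, AnalyticOnNhd ℂ (f i) (ball x r)) (hM : ∀ i, ∀ y ∈ ball x r, ‖f i y‖ ≤ u i) :
    AnalyticAt ℂ (fun y => ∑' i, f i y) x := by
  have he : 0 < Real.exp 1 := Real.exp_pos 1
  have hu0 : ∀ i, 0 ≤ u i := fun i => (norm_nonneg _).trans (hM i x (mem_ball_self hr))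
  set q : ∀ i : ℕ, FormalMultilinearSeries ℂ E F :=
    fun i k => (k.factorial : ℂ)⁻¹ • iteratedFDeriv ℂ k (f i) x with hq
  have hqb : ∀ i k, ‖q i k‖ ≤ u i * (Real.exp 1 * (2 * Real.exp 1 / r) ^ k) := fun i k => by
    rw [← mul_assoc]
    exact norm_iteratedFDeriv_div_factorial_le hr k x (hf i) (hM i)
  have hqs : ∀ k, Summable fun i => q i k := fun k =>
    .of_norm_bounded (hu.mul_right _) fun i => hqb i k
  have hρ0 : 0 < r / (4 * Real.exp 1) := by positivity
  set ρ : NNReal := ⟨r / (4 * Real.exp 1), hρ0.le⟩ with hρ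
  have hρr : (ρ : ℝ) = r / (4 * Real.exp 1) := rfl
  have hhalf : 2 * Real.exp 1 / r * ρ = 1 / 2 := by rw [hρr]; field_simp; norm_num
  set P : FormalMultilinearSeries ℂ E F := fun k => ∑' i, q i k with hP
  have hPb : ∀ k, ‖P k‖ ≤ (∑' i, u i) * (Real.exp 1 * (2 * Real.exp 1 / r) ^ k) := fun k => by
    rw [← tsum_mul_right]
    exact tsum_of_norm_bounded (hu.mul_right _).hasSum fun i => hqb i k
  have hρpos : (0 : ENNReal) < ρ := by exact_mod_cast hρ0
  refine HasFPowerSeriesOnBall.analyticAt (p := P) (r := ρ) ⟨?_, hρpos, fun {y} hy => ?_⟩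
  · refine P.le_radius_of_bound ((∑' i, u i) * Real.exp 1) fun k => ?_
    have hU : 0 ≤ ∑' i, u i := tsum_nonneg hu0
    calc ‖P k‖ * (ρ : ℝ) ^ k
        ≤ (∑' i, u i) * (Real.exp 1 * (2 * Real.exp 1 / r) ^ k) * (ρ : ℝ) ^ k := by
          gcongr; exact hPb k
      _ = (∑' i, u i) * Real.exp 1 * (1 / 2) ^ k := by
          rw [← hhalf, mul_pow]; ring
      _ ≤ (∑' i, u i) * Real.exp 1 * 1 := by
          gcongr; exact pow_le_one₀ (by norm_num) (by norm_num)
      _ = _ := mul_one _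
  · rw [Metric.eball_coe, mem_ball_zero_iff] at hy
    -- Absolute summability of the double series of Taylor terms permits summing over `i` first,
    -- which gives the power series `P`.
    have hsum : Summable fun ik : ℕ × ℕ => q ik.1 ik.2 fun _ => y := by
      refine Summable.of_norm_bounded
        (g := fun ik : ℕ × ℕ => u ik.1 * (Real.exp 1 * (1 / 2) ^ ik.2)) ?_ fun ik => ?_
      · exact hu.mul_of_nonneg ((summable_geometric_of_lt_one (by norm_num)
          (by norm_num)).mul_left _) hu0 fun k => by positivity
      · refine ((q ik.1 ik.2).le_opNorm _).trans ?_
        simp only [Finset.prod_const, Finset.card_fin]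
        calc ‖q ik.1 ik.2‖ * ‖y‖ ^ ik.2
            ≤ u ik.1 * (Real.exp 1 * (2 * Real.exp 1 / r) ^ ik.2) * (ρ : ℝ) ^ ik.2 := by
              gcongr
              · exact mul_nonneg (hu0 _) (by positivity)
              · exact hqb _ _
          _ = _ := by rw [← hhalf, mul_pow]; ring
    have h1 : HasSum (fun ik : ℕ × ℕ => q ik.1 ik.2 fun _ => y) (∑' i, f i (x + y)) := by
      have := hsum.hasSum
      rwa [← this.prod_fiberwise (fun i =>
        (hf i).hasSum_taylor_of_norm_le hr (hM i) (y := y) hy) |>.tsum_eq] at this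
    have h2 := (Equiv.prodComm ℕ ℕ).hasSum_iff.2 h1
    refine h2.prod_fiberwise fun k => ?_
    exact ((hqs k).hasSum.mapL (ContinuousMultilinearMap.apply ℂ (fun _ : Fin k => E) F fun _ => y))

/-! ### Order of vanishing and leading terms at a fixed point -/

section Jets

open Filter Topology Asymptotics

variable {E F : Type*} [NormedAddCommGroup E] [NormedSpace ℂ E] [NormedAddCommGroup F]
  [NormedSpace ℂ F] {f : E → F}

theorem HasFPowerSeriesAt.isBigO_pow_iff {p : FormalMultilinearSeries ℂ E F}
    (hp : HasFPowerSeriesAt f p 0) (k : ℕ) :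
    f =O[𝓝 0] (fun x => ‖x‖ ^ k) ↔ ∀ j < k, ∀ y, (p j fun _ => y) = 0 := by
  constructor
  · intro hf j
    induction j using Nat.strong_induction_on with
    | _ j ih =>
      intro hj
      have hps : p.partialSum (j + 1) = fun y => p j fun _ => y := by
        funext z
        refine Finset.sum_eq_single _ (fun b hb hne => ?_) fun hn => ?_
        · have hbj := (Finset.mem_range_succ_iff.mp hb).lt_of_ne hne
          exact ih b hbj (hbj.trans hj) z
        · exact (hn (Finset.mem_range.mpr (lt_add_one j))).elim
      have h1 := hp.isBigO_sub_partialSum_pow (j + 1)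
      simp only [hps, zero_add] at h1
      have h2 : f =O[𝓝 0] fun x => ‖x‖ ^ (j + 1) :=
        hf.trans (.of_norm_eventuallyLE ?_)
      · have h3 := h2.sub h1
        simp only [sub_sub_cancel] at h3
        -- A homogeneous term of degree `j` that is `O(‖x‖ ^ (j + 1))` vanishes on the diagonal.
        exact h3.continuousMultilinearMap_apply_eq_zero
      · filter_upwards [Metric.ball_mem_nhds (0 : E) one_pos] with x hx
        rw [Real.norm_of_nonneg (by positivity)]
        exact pow_le_pow_of_le_one (norm_nonneg x) (mem_ball_zero_iff.1 hx).le hj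
  · intro h
    have h1 := hp.isBigO_sub_partialSum_pow k
    have : p.partialSum k = 0 := by
      funext y
      exact Finset.sum_eq_zero fun j hj => h j (Finset.mem_range.1 hj) y
    simpa [this] using h1

/-- A function that is analytic at `0` is `O(‖x‖ ^ k)` if and only if its derivatives of order
less than `k` vanish. -/
theorem AnalyticAt.isBigO_pow_iff [CompleteSpace F] (hf : AnalyticAt ℂ f 0) (k : ℕ) :
    f =O[𝓝 0] (fun x => ‖x‖ ^ k) ↔ ∀ j < k, iteratedFDeriv ℂ j f 0 = 0 := by
  obtain ⟨p, r, hp⟩ := hf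
  constructor
  · intro h j hj
    have hz := (hp.hasFPowerSeriesAt.isBigO_pow_iff k).1 h
    -- Only the diagonal values of `p j` are known to vanish, since `p` need not be symmetric.
    -- Replacing these coefficients by `0` leaves the sums unchanged.
    let q : FormalMultilinearSeries ℂ E F := fun i => if i < k then 0 else p i
    have hq : HasFPowerSeriesOnBall f q 0 r := by
      refine ⟨hp.r_le.trans ?_, hp.r_pos, fun {y} hy => ?_⟩
      · refine FormalMultilinearSeries.radius_le_of_le fun {n} => ?_
        by_cases hn : n < k <;> simp [q, hn]
      · convert hp.hasSum hy using 2 with i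
        by_cases hi : i < k
        · simp [q, hi, hz i hi y]
        · simp [q, hi]
    ext v
    rw [hq.iteratedFDeriv_eq_sum_of_completeSpace]
    simp [q, hj]
  · intro h
    refine (hp.hasFPowerSeriesAt.isBigO_pow_iff k).2 fun j hj y => ?_
    rw [← hp.iteratedFDeriv_apply_diag, h j hj]
    simp

theorem AnalyticAt.isBigO_sub_leadingTerm [CompleteSpace F] (hf : AnalyticAt ℂ f 0) {k : ℕ}
    (h : f =O[𝓝 0] fun x => ‖x‖ ^ k) :
    (fun x => f x - ((k.factorial : ℂ)⁻¹ • iteratedFDeriv ℂ k f 0 : E [×k]→L[ℂ] F) fun _ => x)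
      =O[𝓝 0] fun x => ‖x‖ ^ (k + 1) := by
  obtain ⟨p, r, hp⟩ := hf
  have hz := (hp.hasFPowerSeriesAt.isBigO_pow_iff k).1 h
  have h1 := hp.hasFPowerSeriesAt.isBigO_sub_partialSum_pow (k + 1)
  refine h1.congr_left fun x => ?_
  rw [zero_add, hp.iteratedFDeriv_apply_diag, FormalMultilinearSeries.partialSum,
    Finset.sum_range_succ, Finset.sum_eq_zero fun j hj => hz j (Finset.mem_range.1 hj) x, zero_add]

theorem analyticAt_diag {k : ℕ} (Q : E [×k]→L[ℂ] F) (x : E) :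
    AnalyticAt ℂ (fun x => Q fun _ => x) x :=
  Q.cpolynomialAt.analyticAt.comp_of_eq
    (f := fun x : E => fun _ : Fin k => x)
    ((ContinuousLinearMap.pi fun _ : Fin k => ContinuousLinearMap.id ℂ E).analyticAt x) rfl

theorem isBigO_diag {k : ℕ} (Q : E [×k]→L[ℂ] F) :
    (fun x => Q fun _ => x) =O[𝓝 0] fun x : E => ‖x‖ ^ k :=
  .of_bound ‖Q‖ (.of_forall fun x => by simpa using Q.le_opNorm fun _ => x)

theorem isBigO_comp_of_analyticAt {γ : E → E} (hγ : AnalyticAt ℂ γ 0) (h0 : γ 0 = 0) :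
    γ =O[𝓝 0] (fun x => ‖x‖) := by
  simpa [h0] using hγ.differentiableAt.isBigO_sub.norm_right

theorem isBigO_comp_of_map_zero {G : Type*} [NormedAddCommGroup G] {f : E → G} {γ : E → E}
    (hγ : AnalyticAt ℂ γ 0) (h0 : γ 0 = 0) {k : ℕ}
    (h : f =O[𝓝 0] fun x => ‖x‖ ^ k) : (fun x => f (γ x)) =O[𝓝 0] fun x => ‖x‖ ^ k := by
  have ht : Tendsto γ (𝓝 0) (𝓝 0) := by simpa [h0] using hγ.continuousAt.tendsto
  exact (h.comp_tendsto ht).trans ((isBigO_comp_of_analyticAt hγ h0).norm_left.pow k)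

theorem isBigO_clm_apply {M : E → F →L[ℂ] F} (hM : AnalyticAt ℂ M 0) {k : ℕ}
    (h : f =O[𝓝 0] fun x => ‖x‖ ^ k) : (fun x => M x (f x)) =O[𝓝 0] fun x => ‖x‖ ^ k := by
  have h1 : M =O[𝓝 0] fun _ => (1 : ℝ) := hM.continuousAt.isBigO_one ℝ
  have h2 : (fun x => M x (f x)) =O[𝓝 0] fun x => ‖M x‖ * ‖f x‖ :=
    .of_bound 1 (.of_forall fun x => by simpa using (M x).le_opNorm (f x))
  refine h2.trans ?_
  simpa using h1.norm_left.mul h.norm_left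

/-- The leading term of `x ↦ M x (f (γ x))` at a fixed point of `γ`. -/
theorem iteratedFDeriv_weightedComp [CompleteSpace F] {γ : E → E} (hγ : AnalyticAt ℂ γ 0) (h0 : γ 0 = 0)
    {M : E → F →L[ℂ] F} (hM : AnalyticAt ℂ M 0) (hf : AnalyticAt ℂ f 0) {k : ℕ}
    (h : f =O[𝓝 0] fun x => ‖x‖ ^ k) (v : Fin k → E) :
    iteratedFDeriv ℂ k (fun x => M x (f (γ x))) 0 v =
      M 0 (iteratedFDeriv ℂ k f 0 fun i => fderiv ℂ γ 0 (v i)) := by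
  set Q : E [×k]→L[ℂ] F := (k.factorial : ℂ)⁻¹ • iteratedFDeriv ℂ k f 0 with hQ
  set A : E →L[ℂ] E := fderiv ℂ γ 0 with hA
  have hfγ : AnalyticAt ℂ (fun x => f (γ x)) 0 := AnalyticAt.comp_of_eq hf hγ h0
  have hMf : AnalyticAt ℂ (fun x => M x (f (γ x))) 0 := (hM.contDiffAt.clm_apply hfγ.contDiffAt).analyticAt
  have hQa : ∀ x, AnalyticAt ℂ (fun x => Q fun _ => x) x := analyticAt_diag Q
  have hQA : AnalyticAt ℂ (fun x => Q fun _ => A x) 0 :=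
    AnalyticAt.comp_of_eq (g := fun x => Q fun _ => x) (hQa 0) (A.analyticAt 0) (map_zero A)
  -- The difference `M x (f (γ x)) - M 0 (Q (A x, …))` splits into three errors of order `k + 1`:
  -- replacing `f` by its leading term, `γ` by `A`, and `M x` by `M 0`.
  have e1 : (fun x => M x (f (γ x)) - M x (Q fun _ => γ x)) =O[𝓝 0] fun x => ‖x‖ ^ (k + 1) := by
    have := isBigO_clm_apply hM (isBigO_comp_of_map_zero hγ h0 (hf.isBigO_sub_leadingTerm h))
    simpa only [map_sub] using this
  have hmax : (fun x => max ‖γ x‖ ‖A x‖) =O[𝓝 0] fun x => ‖x‖ := by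
    have h1 := (isBigO_comp_of_analyticAt hγ h0).norm_left
    have h2 : (fun x => ‖A x‖) =O[𝓝 0] fun x => ‖x‖ := (A.isBigO_id _).norm_norm
    refine .trans (.of_bound 1 (.of_forall fun x => ?_)) (h1.add h2)
    rw [Real.norm_of_nonneg (le_max_of_le_left (norm_nonneg _)), one_mul,
      Real.norm_of_nonneg (by positivity)]
    exact max_le (by linarith [norm_nonneg (A x)]) (by linarith [norm_nonneg (γ x)])
  have hquad : (fun x => γ x - A x) =O[𝓝 0] fun x => ‖x‖ ^ 2 := by
    obtain ⟨p, hp⟩ := hγ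
    have h1 := hp.isBigO_sub_partialSum_pow 2
    refine h1.congr_left fun x => ?_
    simp [FormalMultilinearSeries.partialSum, Finset.sum_range_succ, hA, hp.fderiv_eq,
      hp.coeff_zero, h0]
    congr 1
    funext i
    fin_cases i
    rfl
  have e2 : (fun x => (Q fun _ => γ x) - Q fun _ => A x) =O[𝓝 0] fun x => ‖x‖ ^ (k + 1) := by
    -- For `k = 0` the form has no arguments and the difference is zero; otherwise it is at most a
    -- constant times `max ‖γ x‖ ‖A x‖ ^ (k - 1) * ‖γ x - A x‖`, of order `(k - 1) + 2`.
    rcases k with _ | k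
    · have : (fun x => (Q fun _ => γ x) - Q fun _ => A x) = fun _ => 0 := by
        funext x
        rw [sub_eq_zero]
        congr 1
        exact Subsingleton.elim _ _
      rw [this]
      exact isBigO_zero _ _
    · have hb : (fun x => (Q fun _ => γ x) - Q fun _ => A x) =O[𝓝 0]
          fun x => max ‖γ x‖ ‖A x‖ ^ k * ‖γ x - A x‖ := by
        refine .of_bound (‖Q‖ * (k + 1)) (.of_forall fun x => ?_)
        have := Q.norm_image_sub_le (fun _ => γ x) (fun _ => A x)
        have e : (fun _ : Fin (k + 1) => γ x) - (fun _ => A x) = fun _ => γ x - A x := rfl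
        rw [e, pi_norm_const, pi_norm_const, pi_norm_const] at this
        rw [Real.norm_of_nonneg (by positivity), ← mul_assoc]
        simpa using this
      refine hb.trans (((hmax.pow k).mul hquad.norm_left).congr_right fun x => ?_)
      ring
  have e3 : (fun x => M x (Q fun _ => A x) - M 0 (Q fun _ => A x)) =O[𝓝 0]
      fun x => ‖x‖ ^ (k + 1) := by
    have h1 : (fun x => M x - M 0) =O[𝓝 0] fun x => ‖x‖ := by
      simpa using hM.differentiableAt.isBigO_sub.norm_right
    have h2 : (fun x => Q fun _ => A x) =O[𝓝 0] fun x => ‖x‖ ^ k :=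
      isBigO_comp_of_map_zero (A.analyticAt 0) (map_zero A) (isBigO_diag Q)
    have hb : (fun x => M x (Q fun _ => A x) - M 0 (Q fun _ => A x)) =O[𝓝 0]
        fun x => ‖M x - M 0‖ * ‖Q fun _ => A x‖ :=
      .of_bound 1 (.of_forall fun x => by
        simpa using (M x - M 0).le_opNorm (Q fun _ => A x))
    refine hb.trans ((h1.norm_left.mul h2.norm_left).congr_right fun x => ?_)
    ring
  have e4 : (fun x => M x (f (γ x)) - M 0 (Q fun _ => A x)) =O[𝓝 0] fun x => ‖x‖ ^ (k + 1) := by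
    refine ((e1.add (isBigO_clm_apply hM e2)).add e3).congr_left fun x => ?_
    simp
  have hMQA : AnalyticAt ℂ (fun x => M 0 (Q fun _ => A x)) 0 :=
    AnalyticAt.comp_of_eq ((M 0).analyticAt _) hQA rfl
  have d1 := ((hMf.sub hMQA).isBigO_pow_iff (k + 1)).1 e4 k (Nat.lt_succ_self k)
  have d2 := ((hf.sub (hQa 0)).isBigO_pow_iff (k + 1)).1 (hf.isBigO_sub_leadingTerm h) k
    (Nat.lt_succ_self k)
  rw [iteratedFDeriv_sub_apply hMf.contDiffAt hMQA.contDiffAt, sub_eq_zero] at d1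
  rw [iteratedFDeriv_sub_apply hf.contDiffAt (hQa 0).contDiffAt, sub_eq_zero] at d2
  rw [d1, d2]
  have hQc : ContDiff ℂ ω fun x => Q fun _ => x :=
    contDiff_iff_contDiffAt.2 fun x => (hQa x).contDiffAt
  change iteratedFDeriv ℂ k (M 0 ∘ ((fun x => Q fun _ => x) ∘ A)) 0 v = _
  rw [(M 0).iteratedFDeriv_comp_left (hQc.comp A.contDiff).contDiffAt (by exact le_top),
    A.iteratedFDeriv_comp_right hQc _ (by exact le_top)]
  simp

end Jets

/-! ### Weighted composition operators over a contraction -/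

section Dynamics

open Filter Topology Asymptotics Metric

variable {E F : Type*} [NormedAddCommGroup E] [NormedSpace ℂ E] [NormedAddCommGroup F]
  [NormedSpace ℂ F]

/-- The weighted composition operator `f ↦ (x ↦ M x (f (γ x)))`. -/
def weightedComp {E F : Type*} [NormedAddCommGroup F] [NormedSpace ℂ F] (M : E → F →L[ℂ] F) (γ : E → E) : Module.End ℂ (E → F) where
  toFun f x := M x (f (γ x))
  map_add' f g := by ext x; simp
  map_smul' c f := by ext x; simp

@[simp]
theorem weightedComp_apply {E F : Type*} [NormedAddCommGroup F] [NormedSpace ℂ F] (M : E → F →L[ℂ] F) (γ : E → E) (f : E → F) (x : E) :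
    weightedComp M γ f x = M x (f (γ x)) := rfl

theorem AnalyticOnNhd.weightedComp [CompleteSpace F] {M : E → F →L[ℂ] F} {γ : E → E} {f : E → F}
    (hM : AnalyticOnNhd ℂ M Set.univ) (hγ : AnalyticOnNhd ℂ γ Set.univ)
    (hf : AnalyticOnNhd ℂ f Set.univ) : AnalyticOnNhd ℂ (weightedComp M γ f) Set.univ :=
  fun x _ => ((hM x trivial).contDiffAt.clm_apply
    (AnalyticAt.comp (hf (γ x) trivial) (hγ x trivial)).contDiffAt).analyticAt

theorem analyticOnNhd_iterate {γ : E → E} (hγ : AnalyticOnNhd ℂ γ Set.univ) (p : ℕ) :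
    AnalyticOnNhd ℂ γ^[p] Set.univ := by
  induction p with
  | zero => exact analyticOnNhd_id
  | succ p ih =>
    rw [Function.iterate_succ]
    exact ih.comp hγ (Set.mapsTo_univ _ _)

/-- Powers of a weighted composition operator are weighted composition operators. -/
theorem exists_weightedComp_pow [CompleteSpace F] {M : E → F →L[ℂ] F} {γ : E → E}
    (hM : AnalyticOnNhd ℂ M Set.univ) (hγ : AnalyticOnNhd ℂ γ Set.univ) (p : ℕ) :
    ∃ M' : E → F →L[ℂ] F, AnalyticOnNhd ℂ M' Set.univ ∧
      weightedComp M γ ^ p = weightedComp M' γ^[p] := by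
  induction p with
  | zero => exact ⟨fun _ => ContinuousLinearMap.id ℂ F, analyticOnNhd_const, by ext; simp⟩
  | succ p ih =>
    obtain ⟨M', hM', h⟩ := ih
    refine ⟨fun x => (M' x).comp (M (γ^[p] x)), fun x _ => ?_, ?_⟩
    · exact ((hM' x trivial).contDiffAt.clm_comp (AnalyticAt.comp (hM _ trivial)
        (analyticOnNhd_iterate hγ p x trivial)).contDiffAt).analyticAt
    · rw [pow_succ, h]
      ext f x
      simp [← Function.iterate_succ_apply', Function.iterate_succ_apply]

/-- A weighted composition operator over a map that halves norms contracts the functions that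
vanish to high order at the origin. -/
theorem norm_weightedComp_pow_le {E F : Type*} [NormedAddCommGroup E] [NormedAddCommGroup F]
    [NormedSpace ℂ F] {M : E → F →L[ℂ] F} {g : E → E} {N : ℕ}
    (hg : ∀ x ∈ ball (0 : E) 1, ‖g x‖ ≤ ‖x‖ / 2) (hM : ∀ x ∈ ball (0 : E) 1, ‖M x‖ ≤ 2 ^ N)
    {S : E → F} {c : ℝ} (hS : ∀ x ∈ ball (0 : E) 1, ‖S x‖ ≤ c * ‖x‖ ^ (N + 1)) (hc : 0 ≤ c)
    (i : ℕ) :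
    ∀ x ∈ ball (0 : E) 1, ‖(weightedComp M g ^ i) S x‖ ≤ c * (1 / 2) ^ i * ‖x‖ ^ (N + 1) := by
  induction i with
  | zero => simpa using hS
  | succ i ih =>
    intro x hx
    have hgx : g x ∈ ball (0 : E) 1 := by
      have h1 := hg x hx
      rw [mem_ball_zero_iff] at hx ⊢
      linarith [norm_nonneg x]
    rw [pow_succ', Module.End.mul_apply, weightedComp_apply]
    calc _ ≤ ‖M x‖ * ‖(weightedComp M g ^ i) S (g x)‖ := (M x).le_opNorm _
      _ ≤ 2 ^ N * (c * (1 / 2) ^ i * (‖x‖ / 2) ^ (N + 1)) := by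
        gcongr
        · exact hM x hx
        · exact (ih _ hgx).trans (by gcongr; exact hg x hx)
      _ = _ := by rw [div_pow, div_pow, div_pow, pow_succ, pow_succ, pow_succ, pow_succ]; field_simp

/-- The series `∑ Tⁱ S` solves `h = S + T h`. -/
theorem exists_analytic_eq_add_weightedComp [CompleteSpace F] {M : E → F →L[ℂ] F} {g : E → E}
    {N : ℕ} (hga : AnalyticOnNhd ℂ g Set.univ) (hMa : AnalyticOnNhd ℂ M Set.univ)
    (hg : ∀ x ∈ ball (0 : E) 1, ‖g x‖ ≤ ‖x‖ / 2) (hM : ∀ x ∈ ball (0 : E) 1, ‖M x‖ ≤ 2 ^ N)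
    (hK : ∀ x, ∃ m : ℕ, g^[m] x ∈ ball (0 : E) 1)
    {S : E → F} (hSa : AnalyticOnNhd ℂ S Set.univ) {c : ℝ}
    (hS : ∀ x ∈ ball (0 : E) 1, ‖S x‖ ≤ c * ‖x‖ ^ (N + 1)) (hc : 0 ≤ c) :
    ∃ h : E → F, AnalyticOnNhd ℂ h Set.univ ∧ h = S + weightedComp M g h ∧
      ∀ x ∈ ball (0 : E) 1, ‖h x‖ ≤ 2 * c * ‖x‖ ^ (N + 1) := by
  set T := weightedComp M g with hT
  have hb := norm_weightedComp_pow_le hg hM hS hc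
  have hgeo : HasSum (fun i : ℕ => c * (1 / 2 : ℝ) ^ i) (2 * c) := by
    have := hasSum_geometric_two.mul_left c
    rwa [mul_comm c 2] at this
  -- Every orbit enters the unit ball, so a property that holds there and passes from `g x` to `x`
  -- holds everywhere.
  have key : ∀ P : E → Prop, (∀ x ∈ ball (0 : E) 1, P x) → (∀ x, P (g x) → P x) → ∀ x, P x := by
    intro P h1 h2 x
    obtain ⟨m, hm⟩ := hK x
    induction m generalizing x with
    | zero => exact h1 x hm
    | succ m ih => exact h2 x (ih (g x) hm)
  have hstep : ∀ (x : E) (i : ℕ), (T ^ (i + 1)) S x = M x ((T ^ i) S (g x)) := fun x i => by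
    rw [pow_succ', Module.End.mul_apply, hT, weightedComp_apply]
  have hsum : ∀ x, Summable fun i => (T ^ i) S x := by
    refine key _ (fun x hx => ?_) fun x hx => ?_
    · exact .of_norm_bounded (hgeo.summable.mul_right _) fun i => hb i x hx
    · rw [← summable_nat_add_iff 1]
      simp_rw [hstep]
      exact (M x).summable hx
  have hTa : ∀ i, AnalyticOnNhd ℂ ((T ^ i) S) Set.univ := fun i => by
    induction i with
    | zero => exact hSa
    | succ i ih => rw [pow_succ', Module.End.mul_apply]; exact .weightedComp hMa hga ih
  set h : E → F := fun x => ∑' i, (T ^ i) S x with hh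
  have heq : h = S + T h := by
    funext x
    rw [hh, Pi.add_apply, hT, weightedComp_apply]
    simp only
    rw [(hsum x).tsum_eq_zero_add, (M x).map_tsum (hsum (g x))]
    simp_rw [hstep]
    rfl
  refine ⟨h, fun x _ => ?_, heq, fun x hx => ?_⟩
  · refine key (fun x => AnalyticAt ℂ h x) (fun x hx => ?_) (fun x hx => ?_) x
    · obtain ⟨r, hr, hrb⟩ := Metric.isOpen_iff.1 isOpen_ball x hx
      refine analyticAt_tsum_of_summable_norm hgeo.summable hr
        (fun i => (hTa i).mono (Set.subset_univ _)) fun i y hy => ?_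
      refine (hb i y (hrb hy)).trans (mul_le_of_le_one_right (by positivity) ?_)
      exact pow_le_one₀ (norm_nonneg _) (mem_ball_zero_iff.1 (hrb hy)).le
    · rw [heq]
      exact (hSa x trivial).add (((hMa x trivial).contDiffAt.clm_apply
        (AnalyticAt.comp hx (hga x trivial)).contDiffAt).analyticAt)
  · exact tsum_of_norm_bounded (hgeo.mul_right _) fun i => hb i x hx

/-- The contraction bound applied to all powers forces a fixed `D` to vanish on the unit ball, and
the fixed point equation carries this back along orbits. -/
theorem eq_zero_of_weightedComp_eq {E F : Type*} [NormedAddCommGroup E]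
    [NormedAddCommGroup F] [NormedSpace ℂ F] {M : E → F →L[ℂ] F} {g : E → E} {N : ℕ}
    (hg : ∀ x ∈ ball (0 : E) 1, ‖g x‖ ≤ ‖x‖ / 2) (hM : ∀ x ∈ ball (0 : E) 1, ‖M x‖ ≤ 2 ^ N)
    (hK : ∀ x, ∃ m : ℕ, g^[m] x ∈ ball (0 : E) 1)
    {D : E → F} {c : ℝ} (hD : ∀ x ∈ ball (0 : E) 1, ‖D x‖ ≤ c * ‖x‖ ^ (N + 1)) (hc : 0 ≤ c)
    (hfix : weightedComp M g D = D) : D = 0 := by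
  have hpow : ∀ i, (weightedComp M g ^ i) D = D := fun i => by
    induction i with
    | zero => rfl
    | succ i ih => rw [pow_succ, Module.End.mul_apply, hfix, ih]
  have hball : ∀ x ∈ ball (0 : E) 1, D x = 0 := fun x hx => by
    have hlim : Tendsto (fun i : ℕ => c * (1 / 2 : ℝ) ^ i * ‖x‖ ^ (N + 1)) atTop (𝓝 0) := by
      have := ((tendsto_pow_atTop_nhds_zero_of_lt_one (r := (1 / 2 : ℝ)) (by norm_num)
        (by norm_num)).const_mul c).mul_const (‖x‖ ^ (N + 1))
      simpa using this
    refine norm_le_zero_iff.1 (ge_of_tendsto' hlim fun i => ?_)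
    have := norm_weightedComp_pow_le hg hM hD hc i x hx
    rwa [hpow] at this
  funext x
  obtain ⟨m, hm⟩ := hK x
  induction m generalizing x with
  | zero => exact hball x hm
  | succ m ih => rw [← hfix, weightedComp_apply, ih (g x) hm]; simp

/-- The higher-order Schwarz lemma turns a bound near `0` into one on the whole unit ball, with `c`
a bound for `S` on the closed ball. It needs only `o(‖x‖ ^ N)` to give the exponent `N + 1`. -/
theorem exists_norm_le_mul_pow_of_isBigO [ProperSpace E] {S : E → F}
    (hS : AnalyticOnNhd ℂ S Set.univ) {N : ℕ} (hO : S =O[𝓝 0] fun x => ‖x‖ ^ (N + 1)) :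
    ∃ c, 0 ≤ c ∧ ∀ x ∈ ball (0 : E) 1, ‖S x‖ ≤ c * ‖x‖ ^ (N + 1) := by
  have h0 : S 0 = 0 := hO.eq_zero_imp.self_of_nhds (by simp)
  obtain ⟨c, hc⟩ := (isCompact_closedBall (0 : E) 1).exists_bound_of_continuousOn
    (hS.continuousOn.mono (Set.subset_univ _))
  refine ⟨c, (norm_nonneg _).trans (hc 0 (by simp)), fun x hx => ?_⟩
  have hlit : (fun x => S x - S 0) =o[𝓝 0] fun x => ‖x - 0‖ ^ N := by
    simp only [h0, sub_zero]
    exact hO.trans_isLittleO (isLittleO_norm_pow_norm_pow (Nat.lt_succ_self N))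
  have := Complex.dist_le_mul_div_pow_of_mapsTo_ball_of_isLittleO (R₁ := 1) (R₂ := c)
    (hS.differentiableOn.mono (Set.subset_univ _)) (fun y hy => ?_) hlit hx
  · simpa [h0] using this
  · simpa [h0] using hc y (ball_subset_closedBall hy)

end Dynamics

/-! ### Eigenvalues of intertwiners and fixed vectors from fixed functionals -/

section LinearAlgebra

/-- A nonzero linear map intertwining `A` and `L` maps some vector to an eigenvector of `L` whose
eigenvalue is also an eigenvalue of `A`. -/
theorem exists_hasEigenvalue_of_intertwining {V W : Type*} [AddCommGroup V] [Module ℂ V]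
    [FiniteDimensional ℂ V] [AddCommGroup W] [Module ℂ W] {A : Module.End ℂ V}
    {L : Module.End ℂ W} {f : V →ₗ[ℂ] W} (hf : f ≠ 0) (h : ∀ v, f (A v) = L (f v)) :
    ∃ a, A.HasEigenvalue a ∧ ∃ v, f v ≠ 0 ∧ L (f v) = a • f v := by
  classical
  -- The generalized eigenspaces of `A` span `V`, so `f` cannot kill all of them.
  obtain ⟨a, ha⟩ : ∃ a, ¬ A.maxGenEigenspace a ≤ LinearMap.ker f := by
    by_contra! hc
    have := iSup_le hc
    rw [Module.End.iSup_maxGenEigenspace_eq_top, top_le_iff, LinearMap.ker_eq_top] at this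
    exact hf this
  obtain ⟨v, hv, hfv⟩ := SetLike.not_le_iff_exists.1 ha
  -- Take the first power of `A - a` for which `f` kills the image of `v`; one power earlier gives a
  -- vector that `f` sends to an eigenvector of `L`.
  have hex : ∃ m, f (((A - algebraMap ℂ (Module.End ℂ V) a) ^ m) v) = 0 := by
    obtain ⟨m, hm⟩ := (Module.End.mem_maxGenEigenspace A a v).1 hv
    exact ⟨m, by rw [Algebra.algebraMap_eq_smul_one, hm, map_zero]⟩
  have hspec := Nat.find_spec hex
  have hpos : Nat.find hex ≠ 0 := fun h0 => by
    rw [h0] at hspec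
    exact hfv (by simpa using hspec)
  obtain ⟨m, hm⟩ := Nat.exists_eq_succ_of_ne_zero hpos
  have hmin : f (((A - algebraMap ℂ (Module.End ℂ V) a) ^ m) v) ≠ 0 := Nat.find_min hex (by omega)
  refine ⟨a, ?_, _, hmin, ?_⟩
  · refine (Module.End.hasUnifEigenvalue_iff_hasUnifEigenvalue_one (k := ⊤) (by simp)).1 fun h0 => ?_
    exact ha (le_of_eq_of_le h0 bot_le)
  · rw [hm, pow_succ', Module.End.mul_apply, LinearMap.sub_apply, map_sub, h, sub_eq_zero] at hspec
    simpa using hspec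

/-- If `f` is a nonzero multilinear map with `f (A v₁, …, A vₖ) = L (f (v₁, …, vₖ))` then `L` has
an eigenvalue which is a product of `k` eigenvalues of `A`. -/
theorem MultilinearMap.exists_hasEigenvalue_prod {V : Type*} [AddCommGroup V] [Module ℂ V]
    [FiniteDimensional ℂ V] (A : V ≃ₗ[ℂ] V) (k : ℕ) {W : Type*} [AddCommGroup W] [Module ℂ W]
    (L : Module.End ℂ W) (f : MultilinearMap ℂ (fun _ : Fin k => V) W) (hf : f ≠ 0)
    (h : ∀ v, f (fun i => A (v i)) = L (f v)) :
    ∃ s : Multiset ℂ, s.card = k ∧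
      (∀ a ∈ s, Module.End.HasEigenvalue (A : V →ₗ[ℂ] V) a) ∧ L.HasEigenvalue s.prod := by
  induction k generalizing L with
  | zero =>
    refine ⟨0, rfl, by simp, ?_⟩
    obtain ⟨v, hv⟩ : ∃ v, f v ≠ 0 := by
      by_contra! hc
      exact hf (MultilinearMap.ext hc)
    refine Module.End.hasEigenvalue_of_hasEigenvector (x := f v)
      ⟨Module.End.mem_eigenspace_iff.2 ?_, hv⟩
    rw [← h v, Subsingleton.elim (fun i => A (v i)) v]
    simp
  | succ k ih =>
    -- With this operator, currying the first argument turns equivariance of `f` into `f.curryLeft`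
    -- intertwining `A` and `L'`.
    let L' : Module.End ℂ (MultilinearMap ℂ (fun _ : Fin k => V) W) :=
      { toFun := fun g => (L.compMultilinearMap g).compLinearMap fun _ => (A.symm : V →ₗ[ℂ] V)
        map_add' := fun g₁ g₂ => by ext; simp
        map_smul' := fun c g => by ext; simp }
    have hL' : ∀ g v, L' g v = L (g fun i => A.symm (v i)) := fun _ _ => rfl
    have hf' : f.curryLeft ≠ 0 := fun h0 => hf (by
      ext v
      have := congr($h0 (v 0) (Fin.tail v))
      simpa using this)
    obtain ⟨a, ha, w, hw, haw⟩ := exists_hasEigenvalue_of_intertwining (A := (A : V →ₗ[ℂ] V))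
      (L := L') hf' fun w => by
        ext v
        rw [hL', f.curryLeft_apply, f.curryLeft_apply, ← h]
        congr 1
        funext i
        refine Fin.cases ?_ (fun i => ?_) i <;> simp
    have ha0 : a ≠ 0 := by
      rintro rfl
      obtain ⟨v, hv⟩ := ha.exists_hasEigenvector
      exact hv.2 (by simpa using hv.apply_eq_smul)
    -- For `g = f.curryLeft w`, the relation `L' g = a • g` evaluated at `A v` reads `g (A v) = a⁻¹
    -- • L (g v)`, so `a` is split off from the product.
    obtain ⟨s, hs, hsA, hsL⟩ := ih (a⁻¹ • L) (f.curryLeft w) hw fun v => by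
      have := congr($haw fun i => A (v i))
      rw [hL'] at this
      simp only [LinearEquiv.symm_apply_apply, smul_apply] at this
      rw [LinearMap.smul_apply, this, inv_smul_smul₀ ha0]
    refine ⟨a ::ₘ s, by simp [hs], by simpa using ⟨ha, hsA⟩, ?_⟩
    obtain ⟨y, hy⟩ := hsL.exists_hasEigenvector
    refine Module.End.hasEigenvalue_of_hasEigenvector (x := y)
      ⟨Module.End.mem_eigenspace_iff.2 ?_, hy.2⟩
    rw [Multiset.prod_cons, mul_smul, ← hy.apply_eq_smul, LinearMap.smul_apply, smul_inv_smul₀ ha0]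

/-- A linear operator that preserves a nonzero functional on a finite-dimensional quotient has a
nonzero fixed vector in that quotient. -/
theorem exists_sub_mem_ker_of_dual_fixed {K H X : Type*} [Field K] [AddCommGroup H] [Module K H]
    [AddCommGroup X] [Module K X] [FiniteDimensional K X] (T : Module.End K H) (J : H →ₗ[K] X)
    (φ : Module.Dual K H) (hT : ∀ x, J x = 0 → J (T x) = 0) (hφ : ∀ x, J x = 0 → φ x = 0)
    (hφT : ∀ x, φ (T x) = φ x) (hφ0 : φ ≠ 0) :
    ∃ x, J x ≠ 0 ∧ J (T x - x) = 0 := by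
  have : FiniteDimensional K (H ⧸ LinearMap.ker J) :=
    LinearEquiv.finiteDimensional J.quotKerEquivRange.symm
  set N := LinearMap.ker J with hN
  have hTN : N ≤ N.comap (T - 1) := fun x hx => by
    have hx' : J x = 0 := hx
    simp [hN, hT x hx', hx']
  set S : Module.End K (H ⧸ N) := N.mapQ N (T - 1) hTN with hS
  -- The functional `φ` vanishes on the range of `T - 1` and on `ker J`; surjectivity on the
  -- quotient would make it zero.
  have hns : ¬ Function.Surjective S := fun hs => by
    refine hφ0 (LinearMap.ext fun y => ?_)
    obtain ⟨x, hx⟩ := hs (N.mkQ y)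
    obtain ⟨x, rfl⟩ := N.mkQ_surjective x
    have hmem : T x - x - y ∈ N := by
      rw [← Submodule.ker_mkQ N, LinearMap.mem_ker, map_sub, ← hx]
      simp [hS]
    have := hφ _ hmem
    simp only [map_sub, hφT, sub_self, zero_sub, neg_eq_zero] at this
    simpa using this
  rw [← LinearMap.injective_iff_surjective, injective_iff_map_eq_zero] at hns
  push Not at hns
  obtain ⟨x, hx, hx0⟩ := hns
  obtain ⟨x, rfl⟩ := N.mkQ_surjective x
  refine ⟨x, fun h0 => hx0 ?_, ?_⟩
  · rwa [Submodule.mkQ_apply, Submodule.Quotient.mk_eq_zero]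
  · simpa [hS, hN, ← Submodule.Quotient.mk_sub, Submodule.Quotient.mk_eq_zero] using hx

/-- An eigenvalue of an endomorphism has an eigencovector. -/
theorem Module.End.HasEigenvalue.exists_dual {K V : Type*} [Field K] [AddCommGroup V] [Module K V]
    [FiniteDimensional K V] {A : Module.End K V} {b : K} (hb : A.HasEigenvalue b) :
    ∃ l : Module.Dual K V, l ≠ 0 ∧ ∀ v, l (A v) = b * l v := by
  have hns : ¬ Function.Surjective (A - algebraMap K (Module.End K V) b) := by
    rw [← LinearMap.injective_iff_surjective, injective_iff_map_eq_zero]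
    intro h
    obtain ⟨v, hv⟩ := hb.exists_hasEigenvector
    exact hv.2 (h v (by simp [hv.apply_eq_smul]))
  rw [← LinearMap.range_eq_top] at hns
  obtain ⟨l, hl0, hl⟩ := Submodule.exists_le_ker_of_lt_top _ (lt_top_iff_ne_top.2 hns)
  refine ⟨l, hl0, fun v => ?_⟩
  have := hl (LinearMap.mem_range_self _ v)
  rw [LinearMap.mem_ker, LinearMap.sub_apply, map_sub, sub_eq_zero] at this
  simpa using this

end LinearAlgebra

/-! ### From a preserved functional on leading terms to an entire fixed point -/

section Existence

open Filter Topology Asymptotics Metric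

variable {E F : Type*} [NormedAddCommGroup E] [NormedSpace ℂ E] [NormedAddCommGroup F]
  [NormedSpace ℂ F]

theorem ContinuousMultilinearMap.finiteDimensional [FiniteDimensional ℂ E] [FiniteDimensional ℂ F]
    (k : ℕ) : FiniteDimensional ℂ (E [×k]→L[ℂ] F) :=
  Module.Finite.of_injective
    (ContinuousMultilinearMap.toMultilinearMapLinear :
      (E [×k]→L[ℂ] F) →ₗ[ℂ] MultilinearMap ℂ (fun _ : Fin k => E) F)
    ContinuousMultilinearMap.toMultilinearMap_injective

variable (E F) in
/-- Entire functions vanishing to order `k` at the origin. -/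
noncomputable def entireVanishing (k : ℕ) : Submodule ℂ (E → F) where
  carrier := {f | AnalyticOnNhd ℂ f Set.univ ∧ f =O[𝓝 0] fun x => ‖x‖ ^ k}
  add_mem' hf hg := ⟨hf.1.add hg.1, hf.2.add hg.2⟩
  zero_mem' := ⟨analyticOnNhd_const, isBigO_zero _ _⟩
  smul_mem' c _ hf := ⟨hf.1.const_smul (c := c), hf.2.const_smul_left c⟩

variable (E F) in
/-- The Taylor coefficients of order at most `N` at the origin. -/
noncomputable def entireVanishing.jet [CompleteSpace F] (k N : ℕ) :
    entireVanishing E F k →ₗ[ℂ] ∀ j : Fin (N + 1), E [×(j : ℕ)]→L[ℂ] F where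
  toFun f j := iteratedFDeriv ℂ j f.1 0
  map_add' f g := by
    ext1 j
    exact iteratedFDeriv_add_apply (f.2.1 0 trivial).contDiffAt (g.2.1 0 trivial).contDiffAt
  map_smul' c f := by
    ext1 j
    exact iteratedFDeriv_const_smul_apply (f.2.1 0 trivial).contDiffAt

theorem entireVanishing.jet_eq_zero_iff [CompleteSpace F] {k N : ℕ} (f : entireVanishing E F k) :
    jet E F k N f = 0 ↔ f.1 =O[𝓝 0] fun x => ‖x‖ ^ (N + 1) := by
  rw [(f.2.1 0 trivial).isBigO_pow_iff, funext_iff, Fin.forall_iff]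
  rfl

/-- Some iterate maps the closed unit ball into the ball of radius `1 / 2`; since it fixes `0`, the
Schwarz lemma gives the linear bound. -/
theorem IsContractionAt.norm_iterate_le {γ : E → E} (hγ : IsContractionAt γ 0)
    (hγa : AnalyticOnNhd ℂ γ Set.univ) [ProperSpace E] :
    ∃ p : ℕ, ∀ x ∈ ball (0 : E) 1, ‖γ^[p] x‖ ≤ ‖x‖ / 2 := by
  obtain ⟨p, hp⟩ := (hγ.eventually_mapsTo (closedBall 0 1) (ball 0 (1 / 2))
    (isCompact_closedBall 0 1) isOpen_ball (by simp)).exists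
  refine ⟨p, fun x hx => ?_⟩
  have h0 : γ^[p] 0 = 0 := Function.iterate_fixed hγ.map_center p
  have := Complex.dist_le_div_mul_dist_of_mapsTo_ball (R₁ := 1) (R₂ := 1 / 2)
    ((analyticOnNhd_iterate hγa p).differentiableOn.mono (Set.subset_univ _)) (fun y hy => by
      rw [h0]
      exact ball_subset_closedBall (hp (ball_subset_closedBall hy))) hx
  rw [h0, dist_zero_right, dist_zero_right] at this
  linarith

/-- A weighted composition operator over a contraction has an entire fixed point as soon as its
action on leading terms of some order `k` preserves a functional that is nonzero on polynomials. -/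
theorem exists_weightedComp_eq_self [FiniteDimensional ℂ E] [FiniteDimensional ℂ F] {γ : E → E}
    (hγ : IsContractionAt γ 0) (hγa : AnalyticOnNhd ℂ γ Set.univ) {M : E → F →L[ℂ] F}
    (hMa : AnalyticOnNhd ℂ M Set.univ) {k : ℕ} (φ : (E [×k]→L[ℂ] F) →ₗ[ℂ] ℂ)
    (hφ : ∀ Q : E [×k]→L[ℂ] F, φ ((M 0).compContinuousMultilinearMap
      (Q.compContinuousLinearMap fun _ => fderiv ℂ γ 0)) = φ Q)
    (Q₀ : E [×k]→L[ℂ] F) (hQ₀ : φ (iteratedFDeriv ℂ k (fun x => Q₀ fun _ => x) 0) ≠ 0) :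
    ∃ f : E → F, AnalyticOnNhd ℂ f Set.univ ∧ f ≠ 0 ∧ weightedComp M γ f = f := by
  have : ProperSpace E := FiniteDimensional.proper ℂ E
  have : CompleteSpace F := FiniteDimensional.complete ℂ F
  have h0 := hγ.map_center
  have hγ0 := hγa 0 trivial
  have hM0 := hMa 0 trivial
  obtain ⟨p, hg⟩ := hγ.norm_iterate_le hγa
  have hga := analyticOnNhd_iterate hγa p
  obtain ⟨M', hMa', hpow⟩ := exists_weightedComp_pow hMa hγa p
  have hK : ∀ x, ∃ m : ℕ, (γ^[p])^[m] x ∈ ball (0 : E) 1 := fun x => by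
    -- If `p = 0`, the identity halves norms on the ball, which forces `E` to be zero.
    rcases p.eq_zero_or_pos with rfl | hp
    · have hsub : ∀ y ∈ ball (0 : E) 1, y = 0 := fun y hy => by
        have := hg y hy
        simp only [Function.iterate_zero, id] at this
        exact norm_le_zero_iff.1 (by linarith)
      refine ⟨0, ?_⟩
      have hc : (((2 * (‖x‖ + 1) : ℝ) : ℂ)⁻¹ • x) = 0 := hsub _ (by
        rw [mem_ball_zero_iff, norm_smul, norm_inv, Complex.norm_real,
          Real.norm_of_nonneg (by positivity), inv_mul_lt_iff₀ (by positivity)]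
        linarith [norm_nonneg x])
      rw [smul_eq_zero, inv_eq_zero, Complex.ofReal_eq_zero] at hc
      rcases hc with hc | rfl
      · linarith [norm_nonneg x]
      · simp
    · obtain ⟨m₀, hm₀⟩ := eventually_atTop.1 (hγ.eventually_mapsTo {x} (ball 0 1)
        isCompact_singleton isOpen_ball (by simp))
      refine ⟨m₀, ?_⟩
      rw [← Function.iterate_mul]
      exact hm₀ (p * m₀) (Nat.le_mul_of_pos_left _ hp) rfl
  obtain ⟨C, hC⟩ := (isCompact_closedBall (0 : E) 1).exists_bound_of_continuousOn
    (hMa'.continuousOn.mono (Set.subset_univ _))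
  obtain ⟨N₀, hN₀⟩ := pow_unbounded_of_one_lt C (one_lt_two (α := ℝ))
  -- The jet must include order `k`, where `φ` lives, and the gain `2 ^ (N + 1)` from vanishing must
  -- beat the bound on `M'`.
  obtain ⟨N, hkN, hN⟩ : ∃ N, k ≤ N ∧ C ≤ 2 ^ N :=
    ⟨max k N₀, le_max_left _ _, hN₀.le.trans (by gcongr <;> simp)⟩
  have hM' : ∀ x ∈ ball (0 : E) 1, ‖M' x‖ ≤ 2 ^ N := fun x hx =>
    (hC x (ball_subset_closedBall hx)).trans hN
  set T := weightedComp M γ with hT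
  have hTO : ∀ {j : ℕ} {f : E → F}, f =O[𝓝 0] (fun x => ‖x‖ ^ j) →
      T f =O[𝓝 0] fun x => ‖x‖ ^ j := fun hf =>
    isBigO_clm_apply hM0 (isBigO_comp_of_map_zero hγ0 h0 hf)
  have hTH : ∀ f ∈ entireVanishing E F k, T f ∈ entireVanishing E F k := fun f hf =>
    ⟨.weightedComp hMa hγa hf.1, hTO hf.2⟩
  -- a fixed vector modulo terms of order `N + 1`
  have hfd : ∀ j : Fin (N + 1), FiniteDimensional ℂ (E [×(j : ℕ)]→L[ℂ] F) := fun j =>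
    ContinuousMultilinearMap.finiteDimensional j
  let J := entireVanishing.jet E F k N
  obtain ⟨f, hfJ, hf⟩ := exists_sub_mem_ker_of_dual_fixed (T.restrict hTH) J
    (φ ∘ₗ LinearMap.proj (⟨k, Nat.lt_succ_of_le hkN⟩ : Fin (N + 1)) ∘ₗ J)
    (fun f hf => by
      rw [entireVanishing.jet_eq_zero_iff] at hf ⊢
      exact hTO hf)
    (fun f hf => by simp [hf])
    (fun f => by
      have := hφ (iteratedFDeriv ℂ k f.1 0)
      change φ (iteratedFDeriv ℂ k (T f.1) 0) = φ (iteratedFDeriv ℂ k f.1 0)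
      rw [← this]
      congr 1
      ext1 v
      exact iteratedFDeriv_weightedComp hγ0 h0 hM0 (f.2.1 0 trivial) f.2.2 v)
    (fun h => hQ₀ (congr($h ⟨fun x => Q₀ fun _ => x, fun x _ => analyticAt_diag Q₀ x,
      isBigO_diag Q₀⟩)))
  -- The fixed jet may have vanishing order-`k` coefficient; only its being nonzero modulo order `N
  -- + 1` is used.
  rw [Ne, entireVanishing.jet_eq_zero_iff] at hfJ
  rw [entireVanishing.jet_eq_zero_iff] at hf
  obtain ⟨f, hfa, hfO⟩ := f
  replace hf : (T f - f) =O[𝓝 0] fun x => ‖x‖ ^ (N + 1) := hf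
  replace hfJ : ¬ f =O[𝓝 0] fun x => ‖x‖ ^ (N + 1) := hfJ
  have hTa : ∀ {f : E → F}, AnalyticOnNhd ℂ f Set.univ → AnalyticOnNhd ℂ (T f) Set.univ :=
    fun hf => .weightedComp hMa hγa hf
  have hSO : ∀ i : ℕ, ((T ^ i) f - f) =O[𝓝 0] fun x => ‖x‖ ^ (N + 1) := fun i => by
    induction i with
    | zero =>
      rw [pow_zero, Module.End.one_apply, sub_self]
      exact isBigO_zero _ _
    | succ i ih =>
      have : (T ^ (i + 1)) f - f = T ((T ^ i) f - f) + (T f - f) := by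
        rw [pow_succ', Module.End.mul_apply, map_sub]; abel
      rw [this]
      exact (hTO ih).add hf
  have hSa : AnalyticOnNhd ℂ ((T ^ p) f - f) Set.univ := by
    rw [hpow]
    exact (AnalyticOnNhd.weightedComp hMa' hga hfa).sub hfa
  obtain ⟨c, hc, hSc⟩ := exists_norm_le_mul_pow_of_isBigO hSa (hSO p)
  obtain ⟨h, hha, hh, hhb⟩ := exists_analytic_eq_add_weightedComp hga hMa' hg hM' hK hSa hSc hc
  rw [← hpow] at hh
  have hhO : h =O[𝓝 0] fun x => ‖x‖ ^ (N + 1) := by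
    refine .of_bound (2 * c) ?_
    filter_upwards [ball_mem_nhds (0 : E) one_pos] with x hx
    simpa using hhb x hx
  have hfix : (T ^ p) (f + h) = f + h := by
    rw [map_add, eq_sub_of_add_eq' hh.symm]
    abel
  -- The defect of `f + h` under `T` is again fixed by `T ^ p`, which commutes with `T`, and
  -- vanishes to order `N + 1`; uniqueness makes it zero.
  have hDO : (T (f + h) - (f + h)) =O[𝓝 0] fun x => ‖x‖ ^ (N + 1) := by
    have : T (f + h) - (f + h) = (T f - f) + (T h - h) := by rw [map_add]; abel
    rw [this]
    exact hf.add ((hTO hhO).sub hhO)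
  have hDa : AnalyticOnNhd ℂ (T (f + h) - (f + h)) Set.univ :=
    (hTa (hfa.add hha)).sub (hfa.add hha)
  obtain ⟨d, hd, hDd⟩ := exists_norm_le_mul_pow_of_isBigO hDa hDO
  have hD := eq_zero_of_weightedComp_eq hg hM' hK hDd hd (by
    rw [← hpow, map_sub, hfix, ← Module.End.mul_apply, ← pow_succ, pow_succ',
      Module.End.mul_apply, hfix])
  refine ⟨f + h, hfa.add hha, fun hz => hfJ ?_, sub_eq_zero.1 hD⟩
  rw [eq_neg_of_add_eq_zero_left hz]
  exact hhO.neg_left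

end Existence

/-! ### Sections of `Hom(Tℂⁿ, End(Tℂⁿ))` as entire functions -/

/-- The trivializations of `Hom(Tℂⁿ, End(Tℂⁿ))` are the identity on fibres. -/
theorem trivializationAt_endForm_snd {n : ℕ} (x₀ x : CSpace n)
    (T : TangentSpace 𝓘(ℂ, CSpace n) x →L[ℂ] TangentSpace 𝓘(ℂ, CSpace n) x →L[ℂ]
      TangentSpace 𝓘(ℂ, CSpace n) x) :
    (trivializationAt (CSpace n →L[ℂ] CSpace n →L[ℂ] CSpace n)
      (fun x : CSpace n => TangentSpace 𝓘(ℂ, CSpace n) x →L[ℂ]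
        TangentSpace 𝓘(ℂ, CSpace n) x →L[ℂ] TangentSpace 𝓘(ℂ, CSpace n) x) x₀
      (Bundle.TotalSpace.mk' (CSpace n →L[ℂ] CSpace n →L[ℂ] CSpace n) x T)).2 = T := by
  rw [hom_trivializationAt_apply]
  ext1 v
  simp only [ContinuousLinearMap.inCoordinates]
  rw [TangentBundle.symmL_model_space]
  have hmem : x ∈ (trivializationAt (CSpace n →L[ℂ] CSpace n)
      (fun x : CSpace n => TangentSpace 𝓘(ℂ, CSpace n) x →L[ℂ] TangentSpace 𝓘(ℂ, CSpace n) x)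
      x₀).baseSet := by
    simp [hom_trivializationAt_baseSet, chartAt_self_eq]
  refine (congrFun ((trivializationAt (CSpace n →L[ℂ] CSpace n)
      (fun x : CSpace n => TangentSpace 𝓘(ℂ, CSpace n) x →L[ℂ] TangentSpace 𝓘(ℂ, CSpace n) x)
      x₀).coe_linearMapAt_of_mem (R := ℂ) hmem) (T v)).trans ?_
  change (trivializationAt (CSpace n →L[ℂ] CSpace n)
      (fun x : CSpace n => TangentSpace 𝓘(ℂ, CSpace n) x →L[ℂ] TangentSpace 𝓘(ℂ, CSpace n) x)
      x₀ (Bundle.TotalSpace.mk' _ x (T v))).2 = _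
  rw [hom_trivializationAt_apply]
  exact inCoordinates_tangent_bundle_core_model_space (I := 𝓘(ℂ, CSpace n))
    (I' := 𝓘(ℂ, CSpace n)) x₀ x x₀ x (show CSpace n →L[ℂ] CSpace n from T v)

theorem contMDiffAt_endForm_iff {n : ℕ} (s : CSpace n → CSpace n →L[ℂ] CSpace n →L[ℂ] CSpace n)
    (x₀ : CSpace n) :
    ContMDiffAt 𝓘(ℂ, CSpace n)
      (𝓘(ℂ, CSpace n).prod 𝓘(ℂ, CSpace n →L[ℂ] CSpace n →L[ℂ] CSpace n)) ω
      (fun x => Bundle.TotalSpace.mk' (CSpace n →L[ℂ] CSpace n →L[ℂ] CSpace n)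
        (E := fun x : CSpace n => TangentSpace 𝓘(ℂ, CSpace n) x →L[ℂ]
          TangentSpace 𝓘(ℂ, CSpace n) x →L[ℂ] TangentSpace 𝓘(ℂ, CSpace n) x) x (s x)) x₀ ↔
    ContDiffAt ℂ ω s x₀ := by
  refine (Bundle.contMDiffAt_section (E := fun x : CSpace n => TangentSpace 𝓘(ℂ, CSpace n) x →L[ℂ]
    TangentSpace 𝓘(ℂ, CSpace n) x →L[ℂ] TangentSpace 𝓘(ℂ, CSpace n) x)
    (s := fun x => s x) x₀).trans ?_
  rw [show (fun x => _) = s from funext fun x => trivializationAt_endForm_snd x₀ x (s x)]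
  exact contMDiffAt_iff_contDiffAt

namespace EquivariantStructure

/-- The `End(Tℂⁿ)`-valued 1-form with a given entire coefficient function. -/
def EndForm.ofAnalytic {n : ℕ} (s : CSpace n → CSpace n →L[ℂ] CSpace n →L[ℂ] CSpace n)
    (hs : AnalyticOnNhd ℂ s Set.univ) :
    EndForm n (CSpace n) (TangentSpace 𝓘(ℂ, CSpace n) : CSpace n → Type) :=
  ⟨s, fun x => (contMDiffAt_endForm_iff s x).2 (hs x trivial).contDiffAt⟩

theorem EndForm.exists_analytic {n : ℕ}
    (R : EndForm n (CSpace n) (TangentSpace 𝓘(ℂ, CSpace n) : CSpace n → Type)) :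
    ∃ s : CSpace n → CSpace n →L[ℂ] CSpace n →L[ℂ] CSpace n,
      AnalyticOnNhd ℂ s Set.univ ∧ ∀ x, s x = R x :=
  ⟨fun x => R x, fun x _ =>
    ((contMDiffAt_endForm_iff (fun x => R x) x).1 (R.contMDiff x)).analyticAt, fun _ => rfl⟩

theorem isInvariant_tangent_iff {n : ℕ} (γ : CSpace.Biholomorphism n)
    (R : EndForm n (CSpace n) (TangentSpace 𝓘(ℂ, CSpace n) : CSpace n → Type))
    (s : CSpace n → CSpace n →L[ℂ] CSpace n →L[ℂ] CSpace n) (hs : ∀ x, s x = R x) :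
    (tangent γ).IsInvariant R ↔
      ∀ x v w, s (γ x) (fderiv ℂ γ x v) (fderiv ℂ γ x w) = fderiv ℂ γ x (s x v w) := by
  unfold IsInvariant pullback
  refine forall_congr' fun x => forall_congr' fun v => ?_
  rw [ContinuousLinearMap.ext_iff]
  refine forall_congr' fun w => ?_
  rw [hs x, hs (γ x), ← mfderiv_eq_fderiv]
  exact ((tangent γ).lift x).symm_apply_eq

theorem fiberEnd_tangent_apply {n : ℕ} (γ : CSpace.Biholomorphism n) (h0 : γ 0 = 0)
    (v : CSpace n) : (tangent γ).fiberEnd 0 h0 v = fderiv ℂ γ 0 v := by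
  have key : ∀ (x y : CSpace n) (h : x = y) (u : TangentSpace 𝓘(ℂ, CSpace n) x),
      LinearEquiv.cast (R := ℂ) (M := (TangentSpace 𝓘(ℂ, CSpace n) : CSpace n → Type)) h u =
        (u : CSpace n) := by
    rintro x _ rfl u
    rfl
  rw [← mfderiv_eq_fderiv]
  exact key _ _ h0 _

end EquivariantStructure

/-! ### Resonance and invariant tensors -/

section Resonance

set_option maxSynthPendingDepth 3

/-- Some product of at least two eigenvalues of `A` is an eigenvalue of `A`. -/
def Module.End.IsResonant {K V : Type*} [Field K] [AddCommGroup V] [Module K V]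
    (A : Module.End K V) : Prop :=
  ∃ s : Multiset K, 2 ≤ s.card ∧ (∀ a ∈ s, A.HasEigenvalue a) ∧ A.HasEigenvalue s.prod

theorem Matrix.isResonant_toMatrix_iff {n : ℕ} {V : Type*} [AddCommGroup V] [Module ℂ V]
    (b : Module.Basis (Fin n) ℂ V) (A : Module.End ℂ V) :
    (LinearMap.toMatrix b b A).IsResonant ↔ A.IsResonant := by
  classical
  have : FiniteDimensional ℂ V := b.finiteDimensional_of_finite
  have hroots : ∀ a, a ∈ (LinearMap.toMatrix b b A).charpoly.roots ↔ A.HasEigenvalue a :=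
      fun a => by
    rw [LinearMap.charpoly_toMatrix, Polynomial.mem_roots A.charpoly_monic.ne_zero,
      Module.End.hasEigenvalue_iff_isRoot_charpoly]
  constructor
  · rintro ⟨α, hα, j, k, hk, h⟩
    have hev : ∀ i, A.HasEigenvalue (α i) := fun i => by
      rw [← hroots, hα]
      exact Multiset.mem_map_of_mem α (Finset.mem_univ_val i)
    refine ⟨∑ i, Multiset.replicate (k i) (α i), ?_, fun a ha => ?_, ?_⟩
    · simpa using hk
    · obtain ⟨i, -, hi⟩ := Multiset.mem_sum.1 ha
      rw [Multiset.eq_of_mem_replicate hi]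
      exact hev i
    · rw [Multiset.prod_sum]
      simpa [← h] using hev j
  · rintro ⟨s, hs, hsA, hA⟩
    have hcard : (LinearMap.toMatrix b b A).charpoly.roots.card = n := by
      rw [IsAlgClosed.card_roots_eq_natDegree, Matrix.charpoly_natDegree_eq_dim, Fintype.card_fin]
    obtain ⟨α, hα⟩ : ∃ α : Fin n → ℂ,
        (LinearMap.toMatrix b b A).charpoly.roots = Finset.univ.val.map α := by
      generalize (LinearMap.toMatrix b b A).charpoly.roots = m at hcard
      subst hcard
      obtain ⟨l, rfl⟩ : ∃ l : List ℂ, (l : Multiset ℂ) = m := Quot.exists_rep m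
      refine ⟨l.get, ?_⟩
      exact (congrArg _ (List.ofFn_get l)).symm.trans (Fin.univ_val_map l.get).symm
    have hev : ∀ a, A.HasEigenvalue a → ∃ i, α i = a := fun a ha => by
      rw [← hroots, hα, Multiset.mem_map] at ha
      obtain ⟨i, -, hi⟩ := ha
      exact ⟨i, hi⟩
    obtain ⟨j, hj⟩ := hev _ hA
    have : Nonempty (Fin n) := ⟨j⟩
    -- Eigenvalues may be repeated among the `α i`, so one index is chosen for each value; the
    -- exponent of `α i` counts the members of `s` assigned to `i`.
    choose! g hg using hev
    refine ⟨α, hα, j, fun i => (s.map g).count i, ?_, ?_⟩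
    · rwa [Multiset.sum_count_eq_card (fun i _ => Finset.mem_univ i), Multiset.card_map]
    · have h1 : ((s.map g).map α).prod = s.prod := by
        rw [Multiset.map_map]
        conv_rhs => rw [← Multiset.map_id s]
        exact congrArg _ (Multiset.map_congr rfl fun a ha => hg a (hsA a ha))
      rw [hj, ← h1, Finset.prod_multiset_map_count]
      refine Finset.prod_subset (Finset.subset_univ _) fun i _ hi => ?_
      rw [Multiset.count_eq_zero.2 (by simpa using hi), pow_zero]

theorem EquivariantStructure.isResonant_tangent_iff {n : ℕ} (γ : CSpace.Biholomorphism n)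
    (h0 : γ 0 = 0) :
    (EquivariantStructure.tangent γ).IsResonant h0 ↔
      Module.End.IsResonant (fderiv ℂ γ 0 : CSpace n →ₗ[ℂ] CSpace n) := by
  have hev : ∀ a, ((EquivariantStructure.tangent γ).fiberEnd 0 h0).HasEigenvalue a ↔
      Module.End.HasEigenvalue (fderiv ℂ γ 0 : CSpace n →ₗ[ℂ] CSpace n) a := fun a => by
    have : (EquivariantStructure.tangent γ).fiberEnd 0 h0 =
        (fderiv ℂ γ 0 : CSpace n →ₗ[ℂ] CSpace n) := LinearMap.ext (EquivariantStructure.fiberEnd_tangent_apply γ h0)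
    rw [this]
    rfl
  constructor
  · rintro ⟨b, b', hb, hb', s, hs, hsA, rfl⟩
    rw [hev] at hb hb'
    refine ⟨b' ::ₘ s, by simpa using hs, by simpa using ⟨hb', hsA⟩, by simpa using hb⟩
  · rintro ⟨s, hs, hsA, h⟩
    obtain ⟨b', hb'⟩ := Multiset.card_pos_iff_exists_mem.1 (by omega : 0 < s.card)
    obtain ⟨t, rfl⟩ := Multiset.exists_cons_of_mem hb'
    rw [Multiset.card_cons] at hs
    refine ⟨_, b', (hev _).2 h, (hev _).2 (hsA _ (Multiset.mem_cons_self _ _)), t, by omega,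
      fun a ha => hsA a (Multiset.mem_cons_of_mem ha), Multiset.prod_cons _ _⟩

variable {V : Type*} [NormedAddCommGroup V] [NormedSpace ℂ V]

/-- The operator `S ↦ ((v, w) ↦ C (S (B v) (B w)))`. -/
noncomputable def bilinearConj (B C : V →L[ℂ] V) :
    (V →L[ℂ] V →L[ℂ] V) →L[ℂ] V →L[ℂ] V →L[ℂ] V :=
  ContinuousLinearMap.compL ℂ V (V →L[ℂ] V) (V →L[ℂ] V)
      (ContinuousLinearMap.compL ℂ V V V C ∘L (ContinuousLinearMap.compL ℂ V V V).flip B) ∘L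
    (ContinuousLinearMap.compL ℂ V V (V →L[ℂ] V)).flip B

@[simp]
theorem bilinearConj_apply (B C : V →L[ℂ] V) (S : V →L[ℂ] V →L[ℂ] V) (v w : V) :
    bilinearConj B C S v w = C (S (B v) (B w)) := rfl

theorem ContDiff.bilinearConj {E : Type*} [NormedAddCommGroup E] [NormedSpace ℂ E]
    {B C : E → V →L[ℂ] V} (hB : ContDiff ℂ ω B) (hC : ContDiff ℂ ω C) :
    ContDiff ℂ ω fun x => bilinearConj (B x) (C x) := by
  unfold _root_.bilinearConj
  fun_prop

/-- The leading term of a nonzero `A`-invariant tensor exhibits a resonance of `A`. -/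
theorem isResonant_of_multilinear [FiniteDimensional ℂ V] (A : V ≃ₗ[ℂ] V) {k : ℕ}
    (S : V [×k]→L[ℂ] V →L[ℂ] V →L[ℂ] V) (hS : S ≠ 0)
    (h : ∀ v u w, S (fun i => A (v i)) (A u) (A w) = A (S v u w)) :
    Module.End.IsResonant (A : V →ₗ[ℂ] V) := by
  let f₀ : MultilinearMap ℂ (fun _ : Fin k => V) (V →ₗ[ℂ] V →ₗ[ℂ] V) :=
    LinearMap.compMultilinearMap
      ((LinearMap.compRight ℂ (ContinuousLinearMap.coeLM ℂ : (V →L[ℂ] V) →ₗ[ℂ] V →ₗ[ℂ] V)) ∘ₗ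
        (ContinuousLinearMap.coeLM ℂ : (V →L[ℂ] V →L[ℂ] V) →ₗ[ℂ] V →ₗ[ℂ] V →L[ℂ] V))
      S.toMultilinearMap
  -- The form slot and the endomorphism slot count as arguments, so there are at least two factors
  -- even when `k = 0`.
  let f : MultilinearMap ℂ (fun _ : Fin (k + 2) => V) V :=
    MultilinearMap.uncurryRight (M := fun _ : Fin (k + 2) => V)
      (MultilinearMap.uncurryRight (M := fun _ : Fin (k + 1) => V) f₀)
  have hf : ∀ m : Fin (k + 2) → V,
      f m = S (Fin.init (Fin.init m)) (Fin.init m (Fin.last k)) (m (Fin.last (k + 1))) :=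
    fun _ => rfl
  obtain ⟨s, hs, hsA, hp⟩ := f.exists_hasEigenvalue_prod A (k + 2) (A : V →ₗ[ℂ] V)
    (fun h0 => hS (by
      ext v u w
      have := hf (Fin.snoc (Fin.snoc v u : Fin (k + 1) → V) w)
      simpa [h0] using this.symm))
    fun v => by
      rw [hf, hf]
      exact h _ _ _
  exact ⟨s, by omega, hsA, hp⟩

-- By the identity theorem a nonzero entire function has a nonzero Taylor coefficient at `0`; the
-- first such order is taken.
open Filter Topology Asymptotics in
theorem exists_iteratedFDeriv_ne_zero {E F : Type*} [NormedAddCommGroup E] [NormedSpace ℂ E]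
    [NormedAddCommGroup F] [NormedSpace ℂ F] [CompleteSpace F] {f : E → F}
    (hf : AnalyticOnNhd ℂ f Set.univ) (hne : f ≠ 0) :
    ∃ k, iteratedFDeriv ℂ k f 0 ≠ 0 ∧ f =O[𝓝 0] fun x => ‖x‖ ^ k := by
  classical
  suffices hex : ∃ k, iteratedFDeriv ℂ k f 0 ≠ 0 from
    ⟨Nat.find hex, Nat.find_spec hex, ((hf 0 trivial).isBigO_pow_iff _).2 fun j hj =>
      not_not.1 (Nat.find_min hex hj)⟩
  by_contra! h
  refine hne (hf.eq_of_eventuallyEq (g := 0) analyticOnNhd_const (z₀ := 0) ?_)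
  obtain ⟨p, r, hp⟩ := hf 0 trivial
  filter_upwards [hp.eventually_hasSum] with y hy
  have : (fun k => p k fun _ => y) = fun _ => 0 := by
    funext k
    rw [← hp.iteratedFDeriv_apply_diag, h k]
    simp
  rw [this, zero_add] at hy
  exact hy.unique hasSum_zero

theorem isResonant_of_weightedComp_eq [FiniteDimensional ℂ V] {γ : V → V} (h0 : γ 0 = 0)
    (hγa : AnalyticAt ℂ γ 0) (A : V ≃L[ℂ] V) (hA : (A : V →L[ℂ] V) = fderiv ℂ γ 0)
    {M : V → (V →L[ℂ] V →L[ℂ] V) →L[ℂ] V →L[ℂ] V →L[ℂ] V} (hMa : AnalyticAt ℂ M 0)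
    (hM0 : M 0 = bilinearConj A A.symm)
    {f : V → V →L[ℂ] V →L[ℂ] V} (hf : AnalyticOnNhd ℂ f Set.univ) (hne : f ≠ 0)
    (hfix : weightedComp M γ f = f) : Module.End.IsResonant (A : V →ₗ[ℂ] V) := by
  have : CompleteSpace V := FiniteDimensional.complete ℂ V
  obtain ⟨k, hk, hO⟩ := exists_iteratedFDeriv_ne_zero hf hne
  refine isResonant_of_multilinear A.toLinearEquiv (iteratedFDeriv ℂ k f 0) hk fun v u w => ?_
  have hv := iteratedFDeriv_weightedComp hγa h0 hMa (hf 0 trivial) hO v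
  change iteratedFDeriv ℂ k (weightedComp M γ f) 0 v = _ at hv
  rw [hfix, hM0, ← hA] at hv
  have := congr(A ($hv u w))
  rw [bilinearConj_apply] at this
  simpa using this.symm

theorem exists_weightedComp_eq_of_isResonant [FiniteDimensional ℂ V] {γ : V → V}
    (hγ : IsContractionAt γ 0) (hγa : AnalyticOnNhd ℂ γ Set.univ) (A : V ≃L[ℂ] V)
    (hA : (A : V →L[ℂ] V) = fderiv ℂ γ 0)
    {M : V → (V →L[ℂ] V →L[ℂ] V) →L[ℂ] V →L[ℂ] V →L[ℂ] V} (hMa : AnalyticOnNhd ℂ M Set.univ)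
    (hM0 : M 0 = bilinearConj A A.symm) (hres : Module.End.IsResonant (A : V →ₗ[ℂ] V)) :
    ∃ f : V → V →L[ℂ] V →L[ℂ] V, AnalyticOnNhd ℂ f Set.univ ∧ f ≠ 0 ∧ weightedComp M γ f = f := by
  obtain ⟨s, hs, hsA, hp⟩ := hres
  obtain ⟨l, rfl⟩ : ∃ l : List ℂ, (l : Multiset ℂ) = s := Quot.exists_rep s
  -- Two factors serve the form and endomorphism slots; the remaining ones set the Taylor order
  -- `l.length`.
  obtain _ | ⟨a, _ | ⟨a', l⟩⟩ := l
  · simp at hs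
  · simp at hs
  simp only [Multiset.mem_coe, Multiset.prod_coe] at hsA hp
  have hev : ∀ b ∈ a :: a' :: l, ∃ v, v ≠ 0 ∧ A v = b • v := fun b hb => by
    obtain ⟨v, hv⟩ := (hsA b hb).exists_hasEigenvector
    exact ⟨v, hv.2, hv.apply_eq_smul⟩
  obtain ⟨u, hu0, hu⟩ := hev a (by simp)
  obtain ⟨u', hu'0, hu'⟩ := hev a' (by simp)
  choose v hv0 hv using fun i : Fin l.length => hev (l.get i) (by simp)
  obtain ⟨ℓ, hℓ0, hℓ⟩ := hp.exists_dual
  set β := (a :: a' :: l).prod with hβ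
  have hβl : β = a * (a' * ∏ i, l.get i) := by
    rw [hβ, List.prod_cons, List.prod_cons, ← List.prod_ofFn, List.ofFn_get]
  -- One functional nonzero on all the eigenvectors makes `Q₀` symmetric in its Taylor arguments, so
  -- symmetrization causes no cancellation.
  obtain ⟨c₀, hc₀⟩ := Module.exists_dual_forall_apply_ne_zero (K := ℂ)
    (fun i : Fin l.length ⊕ Bool => i.elim v fun b => bif b then u else u') (by
      rintro (i | _ | _)
      exacts [hv0 i, hu'0, hu0])
  set c : V →L[ℂ] ℂ := LinearMap.toContinuousLinearMap c₀ with hc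
  have hcv : ∀ i, c (v i) ≠ 0 := fun i => hc₀ (.inl i)
  have hcu : c u ≠ 0 := hc₀ (.inr true)
  have hcu' : c u' ≠ 0 := hc₀ (.inr false)
  obtain ⟨w₀, hw₀⟩ : ∃ w, ℓ w ≠ 0 := by
    by_contra! h
    exact hℓ0 (LinearMap.ext h)
  let φ : (V [×l.length]→L[ℂ] V →L[ℂ] V →L[ℂ] V) →ₗ[ℂ] ℂ :=
    { toFun := fun Q => ℓ (Q v u u')
      map_add' := fun _ _ => by simp
      map_smul' := fun _ _ => by simp }
  have hφ : ∀ Q, φ Q = ℓ (Q v u u') := fun _ => rfl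
  let Q₀ : V [×l.length]→L[ℂ] V →L[ℂ] V →L[ℂ] V :=
    ((ContinuousMultilinearMap.mkPiAlgebra ℂ (Fin l.length) ℂ).compContinuousLinearMap
      fun _ => c).smulRight (c.smulRight (c.smulRight w₀))
  have hQ₀ : ∀ m u u', Q₀ m u u' = (∏ i, c (m i)) • c u • c u' • w₀ := fun m u u' => by
    simp [Q₀]
  refine exists_weightedComp_eq_self hγ hγa hMa φ (fun Q => ?_) Q₀ ?_
  · have e : (fun i => A (v i)) = fun i => l.get i • v i := funext hv
    have key : ∀ x, ℓ (A.symm (β • x)) = ℓ x := fun x => by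
      have := hℓ (A.symm x)
      rw [map_smul, map_smul, smul_eq_mul, ← this]
      simp
    rw [hφ, hφ, hM0, ← hA]
    simp only [ContinuousLinearMap.compContinuousMultilinearMap_coe, Function.comp_apply,
      ContinuousMultilinearMap.compContinuousLinearMap_apply, bilinearConj_apply,
      ContinuousLinearEquiv.coe_coe, e, hu, hu', Q.map_smul_univ]
    rw [← key (Q v u u'), hβl]
    congr 2
    simp [smul_smul]
    ring_nf
  -- The derivative sums `Q₀` over permutations of its arguments, giving `l.length !` times a
  -- nonzero value.
  · rw [hφ, ContinuousMultilinearMap.iteratedFDeriv_comp_diagonal]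
    have : ∀ σ : Equiv.Perm (Fin l.length), Q₀ (fun i => v (σ i)) u u' = Q₀ v u u' := fun σ => by
      rw [hQ₀, hQ₀, Equiv.prod_comp σ fun i => c (v i)]
    simp only [sum_apply, this]
    simp [hQ₀, hcu, hcu', hw₀, hcv, Finset.prod_ne_zero_iff, Nat.factorial_ne_zero,
      Fintype.card_perm]

end Resonance

/-! ### The equivalence -/

set_option maxSynthPendingDepth 3 in
theorem mainTheorem9 (n : ℕ) (γ : CSpace.Biholomorphism n)
    (hγ : IsContractionAt (γ : CSpace n → CSpace n) 0) :
    List.TFAE [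
      (CSpace.jacobian γ 0).IsResonant,
      ∃ R : EquivariantStructure.EndForm n (CSpace n)
          (TangentSpace 𝓘(ℂ, CSpace n) : CSpace n → Type),
        (∃ x, R x ≠ 0) ∧ (EquivariantStructure.tangent γ).IsInvariant R,
      (EquivariantStructure.tangent γ).IsResonant hγ.map_center] := by
  have h0 : γ 0 = 0 := hγ.map_center
  have hγc : ContDiff ℂ ω γ := γ.contMDiff.contDiff
  have hγc' : ContDiff ℂ ω γ.symm := γ.symm.contMDiff.contDiff
  have hγa : AnalyticOnNhd ℂ γ Set.univ := fun x _ => hγc.contDiffAt.analyticAt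
  have hd : ∀ x, DifferentiableAt ℂ γ x := fun x => (hγa x trivial).differentiableAt
  have hd' : ∀ x, DifferentiableAt ℂ γ.symm x := fun x =>
    (hγc'.contDiffAt.analyticAt (x := x)).differentiableAt
  set B : CSpace n → CSpace n →L[ℂ] CSpace n := fun x => fderiv ℂ γ x with hB
  set C : CSpace n → CSpace n →L[ℂ] CSpace n := fun x => fderiv ℂ γ.symm (γ x) with hC
  have hCB : ∀ x v, C x (B x v) = v := fun x v => by
    have h1 : γ.symm ∘ γ = id := funext γ.symm_apply_apply
    have h2 := fderiv_comp x (hd' (γ x)) (hd x)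
    rw [h1, fderiv_id] at h2
    exact congr($h2.symm v)
  have hBC : ∀ x v, B x (C x v) = v := fun x v => by
    have h1 : γ ∘ γ.symm = id := funext γ.apply_symm_apply
    have h2 := fderiv_comp (γ x) (hd (γ.symm (γ x))) (hd' (γ x))
    rw [h1, fderiv_id, γ.symm_apply_apply] at h2
    exact congr($h2.symm v)
  have hBc : ContDiff ℂ ω B := hγc.fderiv_right (by simp)
  have hCc : ContDiff ℂ ω C :=
    (hγc'.fderiv_right (by simp) : ContDiff ℂ ω (fderiv ℂ γ.symm)).comp hγc
  let M := fun x => bilinearConj (B x) (C x)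
  have hMa : AnalyticOnNhd ℂ M Set.univ := fun x _ =>
    (ContDiff.bilinearConj hBc hCc).contDiffAt.analyticAt
  let A : CSpace n ≃L[ℂ] CSpace n := .equivOfInverse (B 0) (C 0) (hCB 0) (hBC 0)
  -- Applying the invertible differential `B x` to both sides clears the inverse `C x` hidden in `M
  -- x`.
  have hinv : ∀ s : CSpace n → CSpace n →L[ℂ] CSpace n →L[ℂ] CSpace n,
      weightedComp M γ s = s ↔
        ∀ x v w, s (γ x) (fderiv ℂ γ x v) (fderiv ℂ γ x w) = fderiv ℂ γ x (s x v w) := fun s => by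
    simp only [funext_iff, ContinuousLinearMap.ext_iff, weightedComp_apply, M, bilinearConj_apply]
    refine forall_congr' fun x => forall_congr' fun v => forall_congr' fun w =>
      ⟨fun h => ?_, fun h => ?_⟩
    · rw [← h]
      exact (hBC x _).symm
    · change C x (s (γ x) (B x v) (B x w)) = _
      rw [show s (γ x) (B x v) (B x w) = B x (s x v w) from h, hCB]
  have h13 : (CSpace.jacobian γ 0).IsResonant ↔
      (EquivariantStructure.tangent γ).IsResonant hγ.map_center :=
    (Matrix.isResonant_toMatrix_iff _ _).trans
      (EquivariantStructure.isResonant_tangent_iff γ h0).symm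
  tfae_have 1 ↔ 3 := h13
  tfae_have 3 → 2 := fun h => by
    obtain ⟨s, hs, hne, hfix⟩ := exists_weightedComp_eq_of_isResonant hγ hγa A rfl hMa rfl
      ((EquivariantStructure.isResonant_tangent_iff γ h0).1 h)
    refine ⟨EquivariantStructure.EndForm.ofAnalytic s hs, ?_,
      (EquivariantStructure.isInvariant_tangent_iff γ _ s fun _ => rfl).2 ((hinv s).1 hfix)⟩
    by_contra! hz
    exact hne (funext hz)
  tfae_have 2 → 3 := fun ⟨R, ⟨x, hx⟩, hR⟩ => by
    obtain ⟨s, hs, hsR⟩ := EquivariantStructure.EndForm.exists_analytic R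
    refine (EquivariantStructure.isResonant_tangent_iff γ h0).2
      (isResonant_of_weightedComp_eq h0 (hγa 0 trivial) A rfl (hMa 0 trivial) rfl hs
        (fun hz => hx ?_) ((hinv s).2 ((EquivariantStructure.isInvariant_tangent_iff γ R s hsR).1 hR)))
    rw [← hsR, hz]
    rfl
  tfae_finish
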